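/- Let $\mathcal Y$ be a connected smooth manifold and let $\mathscr H_1,\mathscr H_2\to\mathcal Y$ be smooth complex Hilbert space bundles with unitary trivializations and model spaces $H_1,H_2$. Let $\mathscr D\to\mathcal Y$ be a further smooth Hilbert space bundle, with model space $\mathcal D$, continuously embedded in $\mathscr H_1$ with fiberwise dense image, such that the trivializations of $\mathscr H_1$ restrict to smooth trivializations of $\mathscr D$ (with respect to a fixed continuous dense embedding $\mathcal D\subset H_1$). Let $\Sigma\subset\mathbb C$ be open and connected, and let $$\mathscr P_y(\sigma):\mathscr D_y\subset\mathscr H_{1,y}\to\mathscr H_{2,y},\qquad (y,\sigma)\in\mathcal Y\times\Sigma,$$ be a family of closed Fredholm operators of index $0$ which, in trivializations, is smooth in $(y,\sigma)$ as a family of bounded operators $\mathcal D\to H_2$, which is holomorphic in $\sigma$, and which for each $y$ is invertible for some $\sigma\in\Sigma$. Put $$\mathrm{sing}_b(\mathscr P_y)=\{\sigma\in\Sigma:\mathscr P_y(\sigma)\text{ is not invertible}\},\qquad \mathrm{sing}_e(\mathscr P)=\{(y,\sigma)\in \mathcal Y\times\Sigma:\sigma\in\mathrm{sing}_b(\mathscr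 P_y)\}.$$ Assume that $\mathrm{sing}_b(\mathscr P_y)$ is finite for each $y$, that $\mathrm{sing}_e(\mathscr P)$ is closed in $\mathcal Y\times\mathbb C$, and that every $y_0\in\mathcal Y$ has a neighborhood $U$ for which $\bigcup_{y\in U}\mathrm{sing}_b(\mathscr P_y)$ is bounded. For $y\in\mathcal Y$ let $\mathscr K_y$ be the complex vector space of all functions $\mathfrak s_\Sigma(\phi)$, where $\phi$ is a $\mathscr D_y$-valued meromorphic function on $\Sigma$ such that $\mathscr P_y\phi$ is holomorphic on $\Sigma$, and $\mathfrak s_\Sigma(\phi)$ is the sum of the singular parts of $\phi$ at its poles, i.e. the finite sum of terms $(\sigma-p)^{-k}a$ with $p\in\Sigma$, $k\ge1$, $a\in\mathscr D_y$ for which $\phi-\mathfrak s_\Sigma(\phi)$ is holomorphic on $\Sigma$. Let $\mathscr K=\bigsqcup_{y\in\mathcal Y}\mathscr K_y$ with the canonical map $\pi:\mathscr K\to\mathcal Y$. Let $\mathscr B^\infty(\mathcal Y;\mathscr K)$ be the space of those right inverses of $\pi$ which, viewed by way of the trivializations as $\mathcal D$-valued functions of $(y,\sigma)$, are smooth on $(\mathcal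 Y\times\mathbb C)\setminus\mathrm{sing}_e(\mathscr P)$ and holomorphic in $\sigma$ there. Then $\pi:\mathscr K\to\mathcal Y$ has the structure of a smooth complex vector bundle of finite rank with fibers the vector spaces $\mathscr K_y$, and with respect to this structure its space of $C^\infty$ sections is exactly $\mathscr B^\infty(\mathcal Y;\mathscr K)$. -/

import Mathlib

open Bundle Filter Topology Set
open scoped Manifold ContDiff

namespace KernelBundle

noncomputable section

/-! ### Vector-valued meromorphic functions and their singular parts -/

section Meromorphic

variable {E F : Type*} [NormedAddCommGroup E] [NormedSpace ℂ E]
  [NormedAddCommGroup F] [NormedSpace ℂ F]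

/-- `f` is holomorphic near `p` after removal of a possible removable singularity at `p`. This is
what holomorphy at `p` means for meromorphic functions, whose values at single points carry no
information. -/
def IsRegularAt (f : ℂ → E) (p : ℂ) : Prop :=
  ∃ g : ℂ → E, AnalyticAt ℂ g p ∧ f =ᶠ[𝓝[≠] p] g

theorem IsRegularAt.zero (p : ℂ) : IsRegularAt (0 : ℂ → E) p :=
  ⟨0, analyticAt_const, EventuallyEq.rfl⟩

theorem IsRegularAt.add {f g : ℂ → E} {p : ℂ} (hf : IsRegularAt f p) (hg : IsRegularAt g p) :
    IsRegularAt (f + g) p := by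
  obtain ⟨f', hf', hf⟩ := hf
  obtain ⟨g', hg', hg⟩ := hg
  exact ⟨f' + g', hf'.add hg', hf.add hg⟩

theorem IsRegularAt.smul {f : ℂ → E} {p : ℂ} (c : ℂ) (hf : IsRegularAt f p) :
    IsRegularAt (c • f) p := by
  obtain ⟨f', hf', hf⟩ := hf
  exact ⟨c • f', hf'.const_smul, hf.const_smul c⟩

/-- The finite sums `∑ (σ - p)⁻ᵏ a` with `p ∈ V`, `k ≥ 1`, `a : E`, i.e. the rational functions on
`ℂ` that vanish at infinity and have their poles in `V`. (The value of such a sum at one of its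
poles is fixed by the convention `0⁻¹ = 0`, so two such sums are equal as soon as they agree off
their poles.) -/
def polarSums (V : Set ℂ) (E : Type*) [NormedAddCommGroup E] [NormedSpace ℂ E] :
    Submodule ℂ (ℂ → E) :=
  Submodule.span ℂ {s | ∃ p ∈ V, ∃ k : ℕ, ∃ a : E, s = fun σ => ((σ - p) ^ (k + 1))⁻¹ • a}

/-- `s` is the sum of the singular parts of `f` at all its poles in `V`: it is a finite sum of
terms `(σ - p)⁻ᵏ a`, `p ∈ V`, `k ≥ 1`, and `f - s` is holomorphic on `V`. -/
def IsSingularPart (V : Set ℂ) (f s : ℂ → E) : Prop :=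
  s ∈ polarSums V E ∧ ∀ p ∈ V, IsRegularAt (f - s) p

/-- The points of `S` at which the family `A` is not invertible. -/
def singPts (S : Set ℂ) (A : ℂ → E →L[ℂ] F) : Set ℂ :=
  {σ | σ ∈ S ∧ ¬ (A σ).IsInvertible}

/-- The space of the singular parts of those `E`-valued meromorphic functions `φ` on `S` for which
`A φ` is holomorphic on `S`. -/
def kernelSpace (S : Set ℂ) (A : ℂ → E →L[ℂ] F) : Submodule ℂ (ℂ → E) where
  carrier := {s | ∃ φ : ℂ → E, MeromorphicOn φ S ∧
    (∀ p ∈ S, IsRegularAt (fun σ => A σ (φ σ)) p) ∧ IsSingularPart S φ s}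
  add_mem' := by
    rintro s t ⟨φ, hφ, hAφ, hs, hs'⟩ ⟨ψ, hψ, hAψ, ht, ht'⟩
    refine ⟨φ + ψ, hφ.add hψ, fun p hp => ?_, add_mem hs ht, fun p hp => ?_⟩
    · have h := (hAφ p hp).add (hAψ p hp)
      have e : (fun σ => A σ ((φ + ψ) σ)) = (fun σ => A σ (φ σ)) + fun σ => A σ (ψ σ) := by
        ext σ; simp
      rwa [e]
    · have h := (hs' p hp).add (ht' p hp)
      have e : φ + ψ - (s + t) = (φ - s) + (ψ - t) := by abel
      rwa [e]
  zero_mem' := by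
    refine ⟨0, fun p _ => MeromorphicAt.const 0 p, fun p _ => ?_, zero_mem _, fun p _ => ?_⟩
    · have e : (fun σ => A σ ((0 : ℂ → E) σ)) = 0 := by ext σ; simp
      rw [e]; exact IsRegularAt.zero p
    · rw [sub_zero]; exact IsRegularAt.zero p
  smul_mem' := by
    rintro c s ⟨φ, hφ, hAφ, hs, hs'⟩
    refine ⟨c • φ, fun p hp => (MeromorphicAt.const c p).smul (hφ p hp), fun p hp => ?_,
      Submodule.smul_mem _ c hs, fun p hp => ?_⟩
    · have h := (hAφ p hp).smul c
      have e : (fun σ => A σ ((c • φ) σ)) = c • fun σ => A σ (φ σ) := by ext σ; simp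
      rwa [e]
    · have h := (hs' p hp).smul c
      rwa [smul_sub] at h

end Meromorphic

/-! ### Smooth complex vector bundles and Hilbert space bundles over a real manifold -/

section Bundles

variable {Y : Type*} [TopologicalSpace Y]

/-- A complex vector bundle is a real vector bundle. With this instance,
`ContMDiffVectorBundle ∞ F E I` says that a complex vector bundle over a real manifold has smooth
transition functions. -/
instance vectorBundleReal (F : Type*) [NormedAddCommGroup F] [NormedSpace ℂ F]
    (E : Y → Type*) [∀ y, AddCommGroup (E y)] [∀ y, Module ℂ (E y)]
    [∀ y, TopologicalSpace (E y)] [TopologicalSpace (TotalSpace F E)] [FiberBundle F E]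
    [VectorBundle ℂ F E] : VectorBundle ℝ F E := by
  have lin : ∀ (e : Trivialization F (π F E)) [MemTrivializationAtlas e], e.IsLinear ℝ := by
    intro e _
    refine ⟨fun y hy => ?_⟩
    have h := Trivialization.linear (R := ℂ) e hy
    refine ⟨h.map_add, fun c x => ?_⟩
    have := h.map_smul (c : ℂ) x
    simpa using this
  refine ⟨fun e _ => lin e, fun e e' _ _ => ?_⟩
  have h := continuousOn_coordChange ℂ e e'
  have h2 : Continuous (fun T : F →L[ℂ] F => T.restrictScalars ℝ) :=
    ContinuousLinearMap.continuous_restrictScalars (𝕜 := ℂ) (𝕜' := ℝ)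
  refine (h2.comp_continuousOn h).congr fun y hy => ?_
  ext v
  simp [Trivialization.coordChangeL_apply _ _ hy]

variable {n : ℕ} [ChartedSpace (EuclideanSpace ℝ (Fin n)) Y]

/-- The trivializations of the bundle are fiberwise unitary. -/
def HasUnitaryTrivializations (F : Type*) [NormedAddCommGroup F] [InnerProductSpace ℂ F]
    (E : Y → Type*) [∀ y, NormedAddCommGroup (E y)] [∀ y, InnerProductSpace ℂ (E y)]
    [TopologicalSpace (TotalSpace F E)] [FiberBundle F E] [VectorBundle ℂ F E] : Prop :=
  ∀ (e : Trivialization F (π F E)) [MemTrivializationAtlas e], ∀ y ∈ e.baseSet, ∀ v : E y,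
    ‖(e ⟨y, v⟩).2‖ = ‖v‖

/-- `e` is a smooth trivialization: it is fiberwise linear and changes smoothly to and from the
members of the trivialization atlas. -/
def IsSmoothTrivialization (n : ℕ) [ChartedSpace (EuclideanSpace ℝ (Fin n)) Y]
    {F : Type*} [NormedAddCommGroup F] [NormedSpace ℂ F]
    {E : Y → Type*} [∀ y, NormedAddCommGroup (E y)] [∀ y, NormedSpace ℂ (E y)]
    [TopologicalSpace (TotalSpace F E)] [FiberBundle F E] [VectorBundle ℂ F E]
    (e : Trivialization F (π F E)) : Prop :=
  ∃ _ : e.IsLinear ℂ, ∀ (e' : Trivialization F (π F E)) [MemTrivializationAtlas e'],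
    ContMDiffOn (𝓡 n) 𝓘(ℝ, F →L[ℂ] F) ∞ (fun y => (e.coordChangeL ℂ e' y : F →L[ℂ] F))
      (e.baseSet ∩ e'.baseSet) ∧
    ContMDiffOn (𝓡 n) 𝓘(ℝ, F →L[ℂ] F) ∞ (fun y => (e'.coordChangeL ℂ e y : F →L[ℂ] F))
      (e'.baseSet ∩ e.baseSet)

/-- The maps `i y : D y → H y` embed the bundle `D` in `H` continuously, with fiberwise dense image,
in such a way that every trivialization of `H` restricts to a smooth trivialization of `D`, in
which the embedding is a fixed continuous dense embedding `j` of the model space of `D` in that of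
`H`. -/
structure IsDenseSubbundle (n : ℕ) [ChartedSpace (EuclideanSpace ℝ (Fin n)) Y]
    {FD F : Type*} [NormedAddCommGroup FD] [NormedSpace ℂ FD]
    [NormedAddCommGroup F] [NormedSpace ℂ F]
    {D H : Y → Type*} [∀ y, NormedAddCommGroup (D y)] [∀ y, NormedSpace ℂ (D y)]
    [TopologicalSpace (TotalSpace FD D)] [FiberBundle FD D] [VectorBundle ℂ FD D]
    [∀ y, NormedAddCommGroup (H y)] [∀ y, NormedSpace ℂ (H y)]
    [TopologicalSpace (TotalSpace F H)] [FiberBundle F H] [VectorBundle ℂ F H]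
    (j : FD →L[ℂ] F) (i : ∀ y, D y →L[ℂ] H y) : Prop where
  injective_model : Function.Injective j
  denseRange_model : DenseRange j
  injective : ∀ y, Function.Injective (i y)
  denseRange : ∀ y, DenseRange (i y)
  restrict : ∀ (e : Trivialization F (π F H)) [MemTrivializationAtlas e],
    ∃ e' : Trivialization FD (π FD D), IsSmoothTrivialization n e' ∧ e'.baseSet = e.baseSet ∧
      ∀ y ∈ e.baseSet, ∀ u : D y, (e ⟨y, i y u⟩).2 = j (e' ⟨y, u⟩).2

/-- `P y σ : D y ⊂ H₁ y → H₂ y`, `σ ∈ S`, is a smooth family of closed Fredholm operators of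
index `0` that is holomorphic in `σ` and, for each `y`, invertible for some `σ`. The inclusions of
the domains are `i y : D y → H₁ y`. -/
structure IsHolomorphicFredholmFamily (n : ℕ) [ChartedSpace (EuclideanSpace ℝ (Fin n)) Y]
    (FD F₂ : Type*) [NormedAddCommGroup FD] [NormedSpace ℂ FD]
    [NormedAddCommGroup F₂] [NormedSpace ℂ F₂]
    {D H₁ H₂ : Y → Type*} [∀ y, NormedAddCommGroup (D y)] [∀ y, NormedSpace ℂ (D y)]
    [TopologicalSpace (TotalSpace FD D)] [FiberBundle FD D] [VectorBundle ℂ FD D]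
    [∀ y, NormedAddCommGroup (H₁ y)] [∀ y, NormedSpace ℂ (H₁ y)]
    [∀ y, NormedAddCommGroup (H₂ y)] [∀ y, NormedSpace ℂ (H₂ y)]
    [TopologicalSpace (TotalSpace F₂ H₂)] [FiberBundle F₂ H₂] [VectorBundle ℂ F₂ H₂]
    (i : ∀ y, D y →L[ℂ] H₁ y) (S : Set ℂ) (P : ∀ y, ℂ → D y →L[ℂ] H₂ y) : Prop where
  smooth : ∀ (e : Trivialization FD (π FD D)) [MemTrivializationAtlas e]
    (e₂ : Trivialization F₂ (π F₂ H₂)) [MemTrivializationAtlas e₂],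
    ContMDiffOn ((𝓡 n).prod 𝓘(ℝ, ℂ)) 𝓘(ℝ, FD →L[ℂ] F₂) ∞
      (fun p : Y × ℂ =>
        (e₂.continuousLinearMapAt ℂ p.1) ∘L (P p.1 p.2) ∘L (e.symmL ℂ p.1))
      ((e.baseSet ∩ e₂.baseSet) ×ˢ S)
  holomorphic : ∀ y, DifferentiableOn ℂ (P y) S
  closed : ∀ y, ∀ σ ∈ S, IsClosed {p : H₁ y × H₂ y | ∃ u : D y, p = (i y u, P y σ u)}
  fredholm : ∀ y, ∀ σ ∈ S, (P y σ).IsFredholm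
  index_eq_zero : ∀ y, ∀ σ ∈ S, (P y σ : D y →ₗ[ℂ] H₂ y).index = 0
  exists_invertible : ∀ y, ∃ σ ∈ S, (P y σ).IsInvertible

/-- The pairs `(y, σ)` with `σ ∈ S` for which `P y σ` is not invertible, as a subset of `Y × ℂ`. -/
def singGraph {D H₂ : Y → Type*} [∀ y, NormedAddCommGroup (D y)] [∀ y, NormedSpace ℂ (D y)]
    [∀ y, NormedAddCommGroup (H₂ y)] [∀ y, NormedSpace ℂ (H₂ y)]
    (S : Set ℂ) (P : ∀ y, ℂ → D y →L[ℂ] H₂ y) : Set (Y × ℂ) :=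
  {p | p.2 ∈ singPts S (P p.1)}

/-- The fiber over `y` of the kernel bundle, as a bare complex vector space: a topology is part
of a vector bundle structure. -/
def KernelFiber {D H₂ : Y → Type*} [∀ y, NormedAddCommGroup (D y)] [∀ y, NormedSpace ℂ (D y)]
    [∀ y, NormedAddCommGroup (H₂ y)] [∀ y, NormedSpace ℂ (H₂ y)]
    (S : Set ℂ) (P : ∀ y, ℂ → D y →L[ℂ] H₂ y) (y : Y) : Type _ :=
  ↥(kernelSpace S (P y))

section KernelFiber

variable {D H₂ : Y → Type*} [∀ y, NormedAddCommGroup (D y)] [∀ y, NormedSpace ℂ (D y)]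
  [∀ y, NormedAddCommGroup (H₂ y)] [∀ y, NormedSpace ℂ (H₂ y)]

instance (S : Set ℂ) (P : ∀ y, ℂ → D y →L[ℂ] H₂ y) (y : Y) : AddCommGroup (KernelFiber S P y) :=
  inferInstanceAs (AddCommGroup ↥(kernelSpace S (P y)))

instance (S : Set ℂ) (P : ∀ y, ℂ → D y →L[ℂ] H₂ y) (y : Y) : Module ℂ (KernelFiber S P y) :=
  inferInstanceAs (Module ℂ ↥(kernelSpace S (P y)))

/-- An element of the fiber over `y`, viewed as a `D y`-valued function on `ℂ`. -/
def KernelFiber.toFun {S : Set ℂ} {P : ∀ y, ℂ → D y →L[ℂ] H₂ y} {y : Y}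
    (s : KernelFiber S P y) : ℂ → D y :=
  Subtype.val (p := fun f : ℂ → D y => f ∈ kernelSpace S (P y)) s

end KernelFiber

/-- The sections of the family of vector spaces `KernelFiber S P y` which, viewed in
trivializations of `D` as functions of `(y, σ)`, are smooth in the complement of the singular set in
`Y × ℂ` and holomorphic in `σ` there. -/
def IsSmoothOffSing (n : ℕ) [ChartedSpace (EuclideanSpace ℝ (Fin n)) Y]
    (FD : Type*) [NormedAddCommGroup FD] [NormedSpace ℂ FD]
    {D H₂ : Y → Type*} [∀ y, NormedAddCommGroup (D y)] [∀ y, NormedSpace ℂ (D y)]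
    [TopologicalSpace (TotalSpace FD D)] [FiberBundle FD D]
    [∀ y, NormedAddCommGroup (H₂ y)] [∀ y, NormedSpace ℂ (H₂ y)]
    (S : Set ℂ) (P : ∀ y, ℂ → D y →L[ℂ] H₂ y) (s : ∀ y, KernelFiber S P y) : Prop :=
  (∀ (e : Trivialization FD (π FD D)) [MemTrivializationAtlas e],
    ContMDiffOn ((𝓡 n).prod 𝓘(ℝ, ℂ)) 𝓘(ℝ, FD) ∞
      (fun p : Y × ℂ => (e ⟨p.1, (s p.1).toFun p.2⟩).2)
      ((e.baseSet ×ˢ univ) \ singGraph S P)) ∧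
  ∀ y, DifferentiableOn ℂ (s y).toFun (singPts S (P y))ᶜ

end Bundles

end

end KernelBundle

open KernelBundle

namespace KernelBundle

noncomputable section

/-! ### Regular points and polar sums -/

section Polar

variable {E F : Type*} [NormedAddCommGroup E] [NormedSpace ℂ E]
  [NormedAddCommGroup F] [NormedSpace ℂ F]

/-! For fixed `y` the space of singular parts measures the failure of multiplication by `P y` to be
onto. Let `K ⊆ S` be compact with the singular points of `P y` in its interior, and let `holo K E`
be the Banach space of continuous functions on `K` that are holomorphic inside. Given `h` in `holo K
F`, the function `(P y)⁻¹ h` is meromorphic near the singular points; it splits uniquely as a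
holomorphic `u` plus a singular part `s`. Thus `(u, s) ↦ P y (u + s)` is a linear bijection onto
`holo K F` (`exists_kernelEquiv`). Finiteness of the pole orders and of the dimension comes from
analytic Fredholm theory: index zero permits a finite rank correction to an invertible operator, and
Cramer's rule for the resulting finite matrix bounds the poles by the vanishing order of a
determinant (`exists_pole_order`).

This makes the kernel spaces stable. Take a basis `b j` of the kernel space at `y₀` and freeze `h j
= P y₀ (b j)`. The operator `(u, c) ↦ P y u + ∑ c j • h j` acts between fixed Banach spaces, is norm
continuous in `y` and is invertible at `y₀`, hence nearby. In terms of the bijection above it is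
block triangular with an identity block, so its invertibility says precisely that the singular parts
of `(P y)⁻¹ (h j)` form a basis of the kernel space at `y` (`exists_stable_basis`).

These frames are smooth off the singular set because they are contour integrals of `(σ - ζ)⁻¹ • (P y
ζ)⁻¹ (h j ζ)` over fixed circles (`contMDiffAt_singularPart`); closedness and local boundedness of
the singular set keep the singular points inside the circles. Conversely, coefficients with respect
to a frame are recovered from finitely many evaluations at points that stay away from the singular
set, so a section that is smooth off the singular set has smooth coefficients
(`exists_coefficients_smooth`). Applied to the members of another frame this gives smooth transition
functions, and applied to arbitrary sections it identifies the smooth ones. The rank is locally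
constant, hence constant on the connected base. -/

theorem IsRegularAt.of_analyticAt {f : ℂ → E} {p : ℂ} (hf : AnalyticAt ℂ f p) : IsRegularAt f p :=
  ⟨f, hf, EventuallyEq.rfl⟩

theorem IsRegularAt.congr {f g : ℂ → E} {p : ℂ} (hf : IsRegularAt f p) (h : f =ᶠ[𝓝[≠] p] g) :
    IsRegularAt g p := by
  obtain ⟨f', hf', hf⟩ := hf
  exact ⟨f', hf', h.symm.trans hf⟩

theorem IsRegularAt.sub {f g : ℂ → E} {p : ℂ} (hf : IsRegularAt f p) (hg : IsRegularAt g p) :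
    IsRegularAt (f - g) p := by
  obtain ⟨f', hf', hf⟩ := hf
  obtain ⟨g', hg', hg⟩ := hg
  exact ⟨f' - g', hf'.sub hg', hf.sub hg⟩

theorem AnalyticAt.clm_apply_of_analyticAt {A : ℂ → E →L[ℂ] F} {f : ℂ → E} {p : ℂ}
    (hA : AnalyticAt ℂ A p) (hf : AnalyticAt ℂ f p) : AnalyticAt ℂ (fun z => A z (f z)) p :=
  AnalyticAt.comp (g := fun x : (E →L[ℂ] F) × E => x.1 x.2) (f := fun z => (A z, f z))
    ((ContinuousLinearMap.id ℂ (E →L[ℂ] F)).analyticAt_bilinear (A p, f p)) (hA.prod hf)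

theorem IsRegularAt.clm_apply {A : ℂ → E →L[ℂ] F} {f : ℂ → E} {p : ℂ} (hA : AnalyticAt ℂ A p)
    (hf : IsRegularAt f p) : IsRegularAt (fun z => A z (f z)) p := by
  obtain ⟨f', hf', hf⟩ := hf
  refine ⟨fun z => A z (f' z), AnalyticAt.clm_apply_of_analyticAt hA hf', ?_⟩
  filter_upwards [hf] with z hz
  rw [hz]

theorem IsRegularAt.analytic_smul {c : ℂ → ℂ} {f : ℂ → E} {p : ℂ} (hc : AnalyticAt ℂ c p)
    (hf : IsRegularAt f p) : IsRegularAt (fun z => c z • f z) p := by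
  obtain ⟨f', hf', hf⟩ := hf
  refine ⟨fun z => c z • f' z, hc.smul hf', ?_⟩
  filter_upwards [hf] with z hz
  rw [hz]

theorem polarSums_mono {V W : Set ℂ} (h : V ⊆ W) : polarSums V E ≤ polarSums W E := by
  apply Submodule.span_mono
  rintro s ⟨p, hp, k, a, rfl⟩
  exact ⟨p, h hp, k, a, rfl⟩

theorem single_mem_polarSums {V : Set ℂ} {p : ℂ} (hp : p ∈ V) (k : ℕ) (a : E) :
    (fun σ => ((σ - p) ^ (k + 1))⁻¹ • a) ∈ polarSums V E :=
  Submodule.subset_span ⟨p, hp, k, a, rfl⟩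

theorem polarSums_empty : polarSums (∅ : Set ℂ) E = ⊥ := by
  rw [polarSums, Submodule.span_eq_bot]
  rintro s ⟨p, hp, -⟩
  exact hp.elim

theorem polarSums_union (V W : Set ℂ) :
    polarSums (V ∪ W) E = polarSums V E ⊔ polarSums W E := by
  apply le_antisymm
  · refine Submodule.span_le.2 ?_
    rintro s ⟨p, hp | hp, k, a, rfl⟩
    · exact Submodule.mem_sup_left (single_mem_polarSums hp k a)
    · exact Submodule.mem_sup_right (single_mem_polarSums hp k a)
  · exact sup_le (polarSums_mono subset_union_left) (polarSums_mono subset_union_right)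

theorem analyticAt_of_mem_polarSums {V : Set ℂ} {s : ℂ → E} (hs : s ∈ polarSums V E) {p : ℂ}
    (hp : p ∉ V) : AnalyticAt ℂ s p := by
  induction hs using Submodule.span_induction with
  | mem s h =>
    obtain ⟨q, hq, k, a, rfl⟩ := h
    have hpq : p - q ≠ 0 := sub_ne_zero.2 fun h => hp (h ▸ hq)
    have : AnalyticAt ℂ (fun σ : ℂ => ((σ - q) ^ (k + 1))⁻¹) p :=
      ((analyticAt_id.sub analyticAt_const).pow _).inv (pow_ne_zero _ hpq)
    exact this.smul analyticAt_const
  | zero => exact analyticAt_const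
  | add s t _ _ h₁ h₂ => exact h₁.add h₂
  | smul c s _ h => exact h.const_smul

theorem meromorphicAt_of_mem_polarSums {V : Set ℂ} {s : ℂ → E} (hs : s ∈ polarSums V E) (p : ℂ) :
    MeromorphicAt s p := by
  induction hs using Submodule.span_induction with
  | mem s h =>
    obtain ⟨q, hq, k, a, rfl⟩ := h
    exact ((((MeromorphicAt.id p).sub (MeromorphicAt.const q p)).pow (k + 1)).inv).smul
      (MeromorphicAt.const a p)
  | zero => exact MeromorphicAt.const 0 p
  | add s t _ _ h₁ h₂ => exact h₁.add h₂
  | smul c s _ h => exact (MeromorphicAt.const c p).smul h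

theorem tendsto_zero_of_mem_polarSums {V : Set ℂ} {s : ℂ → E} (hs : s ∈ polarSums V E) :
    Tendsto s (cocompact ℂ) (𝓝 0) := by
  induction hs using Submodule.span_induction with
  | mem s h =>
    obtain ⟨q, hq, k, a, rfl⟩ := h
    have h₁ : Tendsto (fun σ : ℂ => σ - q) (cocompact ℂ) (cocompact ℂ) :=
      (Homeomorph.subRight q).isClosedEmbedding.tendsto_cocompact
    have h₂ : Tendsto (fun σ : ℂ => ((σ - q) ^ (k + 1))⁻¹) (cocompact ℂ) (𝓝 0) := by
      simp_rw [← inv_pow]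
      have := ((tendsto_inv₀_cobounded (α := ℂ)).comp
        (by rwa [← Metric.cobounded_eq_cocompact] at h₁)).pow (k + 1)
      simpa [Function.comp_def, ← Metric.cobounded_eq_cocompact] using this
    simpa using h₂.smul_const a
  | zero => exact tendsto_const_nhds
  | add s t _ _ h₁ h₂ => simpa [Pi.add_def] using h₁.add h₂
  | smul c s _ h => simpa [Pi.smul_def] using h.const_smul c

/-- This is the convention `0⁻¹ = 0`. It turns vanishing off the pole into vanishing as a function
on all of `ℂ`. -/
theorem apply_eq_zero_of_mem_polarSums_singleton {p : ℂ} {s : ℂ → E}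
    (hs : s ∈ polarSums {p} E) : s p = 0 := by
  induction hs using Submodule.span_induction with
  | mem s h =>
    obtain ⟨q, rfl, k, a, rfl⟩ := h
    simp
  | zero => rfl
  | add s t _ _ h₁ h₂ => simp [h₁, h₂]
  | smul c s _ h => simp [h]

/-- Liouville's theorem: with the removable singularity filled in, `s` is entire and tends to `0` at
infinity. -/
theorem eq_zero_of_mem_polarSums_singleton {p : ℂ} {s : ℂ → E} (hs : s ∈ polarSums {p} E)
    (hr : IsRegularAt s p) : s = 0 := by
  obtain ⟨g, hg, hsg⟩ := hr
  have hd : Differentiable ℂ (Function.update s p (g p)) := by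
    intro z
    rcases eq_or_ne z p with rfl | hz
    · refine hg.differentiableAt.congr_of_eventuallyEq ?_
      rw [EventuallyEq, eventually_nhdsWithin_iff] at hsg
      filter_upwards [hsg] with w hw
      rcases eq_or_ne w z with rfl | hne
      · simp
      · simp [hne, hw hne]
    · have := (analyticAt_of_mem_polarSums hs (p := z) hz).differentiableAt
      refine this.congr_of_eventuallyEq ?_
      filter_upwards [isOpen_ne.mem_nhds hz] with w hw
      simp [Function.update_of_ne hw]
  have ht : Tendsto (Function.update s p (g p)) (cocompact ℂ) (𝓝 0) := by
    refine (tendsto_zero_of_mem_polarSums hs).congr' ?_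
    filter_upwards [(isCompact_singleton (x := p)).compl_mem_cocompact] with w hw
    rw [Function.update_of_ne hw]
  ext z
  rcases eq_or_ne z p with rfl | hz
  · exact apply_eq_zero_of_mem_polarSums_singleton hs
  · simpa [Function.update_of_ne hz] using hd.apply_eq_of_tendsto_cocompact z ht

theorem mem_polarSums_diff_singleton {V : Set ℂ} {s : ℂ → E} (hs : s ∈ polarSums V E) {p : ℂ}
    (hr : IsRegularAt s p) : s ∈ polarSums (V \ {p}) E := by
  have hs' : s ∈ polarSums ({p} ∪ V \ {p}) E :=
    polarSums_mono (by rw [union_sdiff_self]; exact subset_union_right) hs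
  rw [polarSums_union, Submodule.mem_sup] at hs'
  obtain ⟨a, ha, b, hb, rfl⟩ := hs'
  have hb' : AnalyticAt ℂ b p := analyticAt_of_mem_polarSums hb (by simp)
  have : a = 0 := eq_zero_of_mem_polarSums_singleton ha (by
    simpa using hr.sub (IsRegularAt.of_analyticAt hb'))
  simpa [this] using hb

theorem exists_finite_of_mem_polarSums {V : Set ℂ} {s : ℂ → E} (hs : s ∈ polarSums V E) :
    ∃ T : Set ℂ, T.Finite ∧ T ⊆ V ∧ s ∈ polarSums T E := by
  induction hs using Submodule.span_induction with
  | mem s h =>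
    obtain ⟨q, hq, k, a, rfl⟩ := h
    exact ⟨{q}, finite_singleton q, singleton_subset_iff.2 hq, single_mem_polarSums (mem_singleton q) k a⟩
  | zero => exact ⟨∅, finite_empty, empty_subset _, zero_mem _⟩
  | add s t _ _ h₁ h₂ =>
    obtain ⟨T₁, hf₁, hT₁, hs₁⟩ := h₁
    obtain ⟨T₂, hf₂, hT₂, hs₂⟩ := h₂
    exact ⟨T₁ ∪ T₂, hf₁.union hf₂, union_subset hT₁ hT₂,
      add_mem (polarSums_mono subset_union_left hs₁) (polarSums_mono subset_union_right hs₂)⟩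
  | smul c s _ h =>
    obtain ⟨T, hf, hT, hs⟩ := h
    exact ⟨T, hf, hT, Submodule.smul_mem _ c hs⟩

/-- A polar sum has only finitely many poles, and those outside `W` can be discarded one at a time,
since the Laurent tail at a regular point is zero. -/
theorem mem_polarSums_of_regular {V W : Set ℂ} {s : ℂ → E} (hs : s ∈ polarSums V E)
    (hr : ∀ p ∈ V, p ∉ W → IsRegularAt s p) : s ∈ polarSums W E := by
  obtain ⟨T, hT, hTV, hs⟩ := exists_finite_of_mem_polarSums hs
  have key : ∀ R : Set ℂ, R.Finite → R ⊆ V → s ∈ polarSums (R ∪ W) E → s ∈ polarSums W E := by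
    intro R hR
    induction R, hR using Set.Finite.induction_on with
    | empty => intro _ h; simpa using h
    | @insert q R hq _ ih =>
      intro hRV h
      refine ih ((subset_insert _ _).trans hRV) ?_
      by_cases hqW : q ∈ W
      · refine polarSums_mono ?_ h
        rintro x ((rfl | hx) | hx)
        exacts [Or.inr hqW, Or.inl hx, Or.inr hx]
      · refine polarSums_mono ?_ (mem_polarSums_diff_singleton h
          (hr q (hRV (mem_insert _ _)) hqW))
        rintro x ⟨(rfl | hx) | hx, hne⟩
        exacts [(hne rfl).elim, Or.inl hx, Or.inr hx]
  exact key T hT hTV (polarSums_mono subset_union_left hs)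

theorem eq_zero_of_mem_polarSums_of_regular {V : Set ℂ} {s : ℂ → E} (hs : s ∈ polarSums V E)
    (hr : ∀ p ∈ V, IsRegularAt s p) : s = 0 := by
  have := mem_polarSums_of_regular (W := ∅) hs fun p hp _ => hr p hp
  rwa [polarSums_empty, Submodule.mem_bot] at this

/-- The complement of the finite pole set is connected, so the identity theorem spreads the
vanishing to all of it; the poles are then removable. -/
theorem eq_zero_of_mem_polarSums_of_eqOn_open {V O : Set ℂ} {s : ℂ → E} (hs : s ∈ polarSums V E)
    (hO : IsOpen O) (hne : O.Nonempty) (h0 : ∀ z ∈ O, s z = 0) : s = 0 := by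
  obtain ⟨T, hT, -, hs⟩ := exists_finite_of_mem_polarSums hs
  have hconn : IsPreconnected Tᶜ :=
    (hT.countable.isConnected_compl_of_one_lt_rank (by
      rw [Complex.rank_real_complex]; norm_num)).isPreconnected
  obtain ⟨z, hzT, hzO⟩ : (Tᶜ ∩ O).Nonempty :=
    (hT.countable.dense_compl ℝ).inter_open_nonempty O hO hne |>.mono fun x hx => ⟨hx.2, hx.1⟩
  have hz : EqOn s 0 Tᶜ := AnalyticOnNhd.eqOn_zero_of_preconnected_of_eventuallyEq_zero
    (fun w hw => analyticAt_of_mem_polarSums hs hw) hconn hzT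
    (by filter_upwards [hO.mem_nhds hzO] with w hw using h0 w hw)
  refine eq_zero_of_mem_polarSums_of_regular hs fun p _ => ⟨0, analyticAt_const, ?_⟩
  have : (T \ {p})ᶜ ∈ 𝓝 p := (hT.subset sdiff_subset).isClosed.isOpen_compl.mem_nhds (by simp)
  rw [EventuallyEq, eventually_nhdsWithin_iff]
  filter_upwards [this] with w hw hwp
  exact hz fun hwT => hw ⟨hwT, hwp⟩

/-- A function with a pole of order at most `m` at `p` is the sum of a Laurent tail of length `m`
and a function regular at `p`. -/
theorem exists_laurent_tail {p : ℂ} (m : ℕ) {f : ℂ → E}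
    (hf : IsRegularAt (fun z => (z - p) ^ m • f z) p) :
    ∃ a : Fin m → E,
      IsRegularAt (f - ∑ k : Fin m, fun z => ((z - p) ^ ((k : ℕ) + 1))⁻¹ • a k) p := by
  induction m generalizing f with
  | zero => exact ⟨0, by simpa using hf⟩
  | succ m ih =>
    obtain ⟨g, ⟨ps, hg⟩, hfg⟩ := hf
    have hd : AnalyticAt ℂ (dslope g p) p := ⟨_, hg.has_fpower_series_dslope_fslope⟩
    -- The leading term is peeled off: subtracting `g p` divided by `(z - p) ^ (m + 1)` leaves the
    -- difference quotient of `g` divided by `(z - p) ^ m`, which has one order less.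
    obtain ⟨a, ha⟩ := ih (f := f - fun z => ((z - p) ^ (m + 1))⁻¹ • g p) (by
      refine ⟨dslope g p, hd, ?_⟩
      filter_upwards [hfg, self_mem_nhdsWithin] with z hz hzp
      have hzp' : z - p ≠ 0 := sub_ne_zero.2 hzp
      have e : f z = ((z - p) ^ (m + 1))⁻¹ • g z := by
        rw [← hz, smul_smul, inv_mul_cancel₀ (pow_ne_zero _ hzp'), one_smul]
      rw [dslope_of_ne _ hzp, slope_def_module, Pi.sub_apply, e, ← smul_sub, smul_smul]
      congr 1
      rw [pow_succ]
      field_simp)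
    -- The index `k` belongs to the order `k + 1`, so the leading coefficient comes last.
    refine ⟨Fin.snoc a (g p), ?_⟩
    rw [Fin.sum_univ_castSucc]
    simpa [sub_sub, add_comm] using ha

theorem exists_mem_polarSums_singleton {p : ℂ} {m : ℕ} {f : ℂ → E}
    (hf : IsRegularAt (fun z => (z - p) ^ m • f z) p) :
    ∃ s ∈ polarSums {p} E, IsRegularAt (f - s) p := by
  obtain ⟨a, ha⟩ := exists_laurent_tail m hf
  refine ⟨_, Submodule.sum_mem _ fun k _ => ?_, ha⟩
  exact single_mem_polarSums (mem_singleton p) k (a k)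

/-- A function with at most poles at the points of a finite set has a sum of singular parts. -/
theorem exists_mem_polarSums_of_finite {Z : Set ℂ} (hZ : Z.Finite) {f : ℂ → E}
    (hf : ∀ p ∈ Z, ∃ m : ℕ, IsRegularAt (fun z => (z - p) ^ m • f z) p) :
    ∃ s ∈ polarSums Z E, ∀ p ∈ Z, IsRegularAt (f - s) p := by
  choose! m hm using hf
  have h := fun p hp => exists_mem_polarSums_singleton (hm p hp)
  choose! t ht htr using h
  refine ⟨∑ p ∈ hZ.toFinset, t p, Submodule.sum_mem _ fun p hp => ?_, fun p hp => ?_⟩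
  · have hp' : p ∈ Z := by simpa using hp
    exact polarSums_mono (singleton_subset_iff.2 hp') (ht p hp')
  · rw [← Finset.add_sum_erase _ _ (hZ.mem_toFinset.2 hp), ← sub_sub]
    refine (htr p hp).sub (IsRegularAt.of_analyticAt ?_)
    refine Finset.analyticAt_sum _ fun q hq => ?_
    simp only [Finset.mem_erase, Finite.mem_toFinset] at hq
    exact analyticAt_of_mem_polarSums (ht q hq.2) fun h => hq.1 h.symm

/-- The difference `φ - s` is regular on `S` and `A` preserves regularity, so `φ` may be replaced by
its own singular part. From here on no auxiliary `φ` is needed. -/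
theorem mem_kernelSpace_iff [CompleteSpace F] {S : Set ℂ} (hS : IsOpen S) {A : ℂ → E →L[ℂ] F}
    (hA : DifferentiableOn ℂ A S) {s : ℂ → E} :
    s ∈ kernelSpace S A ↔ s ∈ polarSums S E ∧ ∀ p ∈ S, IsRegularAt (fun σ => A σ (s σ)) p := by
  constructor
  · rintro ⟨φ, -, hφ, hs, hr⟩
    refine ⟨hs, fun p hp => ?_⟩
    have h := (hφ p hp).sub ((hr p hp).clm_apply (hA.analyticAt (hS.mem_nhds hp)))
    refine h.congr (Eventually.of_forall fun z => ?_)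
    simp
  · rintro ⟨hs, hr⟩
    refine ⟨s, fun p _ => meromorphicAt_of_mem_polarSums hs p, hr, hs, fun p _ => ?_⟩
    rw [sub_self]
    exact IsRegularAt.zero p

end Polar

/-! ### Analytic Fredholm theory at a point -/

section Fredholm

variable {E F : Type*} [NormedAddCommGroup E] [NormedSpace ℂ E]
  [NormedAddCommGroup F] [NormedSpace ℂ F]

/-- `T` becomes invertible after the addition of an operator that factors through a
finite-dimensional space. -/
def HasFiniteRankCorrection (T : E →L[ℂ] F) : Prop :=
  ∃ (N : ℕ) (C : E →L[ℂ] (Fin N → ℂ)) (B : (Fin N → ℂ) →L[ℂ] F), (T + B ∘L C).IsInvertible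

/-- Index zero makes the kernel and the cokernel isomorphic to the same `ℂᴺ`. Projecting to the
kernel and mapping it by such an isomorphism onto a complement of the range corrects both defects of
`T` at once. -/
theorem hasFiniteRankCorrection_of_isFredholm [CompleteSpace E] [CompleteSpace F] {T : E →L[ℂ] F}
    (hT : T.IsFredholm) (h0 : (T : E →ₗ[ℂ] F).index = 0) : HasFiniteRankCorrection T := by
  have := hT.finite_ker
  have : FiniteDimensional ℂ (F ⧸ (T : E →ₗ[ℂ] F).range) := hT.finite_coker
  obtain ⟨p, hp⟩ := hT.closedComplemented_ker
  have hdim : Module.finrank ℂ (T : E →ₗ[ℂ] F).ker = Module.finrank ℂ (F ⧸ (T : E →ₗ[ℂ] F).range) := by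
    rw [LinearMap.index] at h0
    omega
  set N := Module.finrank ℂ (T : E →ₗ[ℂ] F).ker with hN
  let eK : (T : E →ₗ[ℂ] F).ker ≃L[ℂ] (Fin N → ℂ) := ContinuousLinearEquiv.ofFinrankEq (by simp [hN])
  let eQ : (F ⧸ (T : E →ₗ[ℂ] F).range) ≃ₗ[ℂ] (Fin N → ℂ) := LinearEquiv.ofFinrankEq _ _ (by simp [← hdim])
  -- A merely linear section of the quotient map suffices: precomposed with `ℂᴺ` it is automatically
  -- continuous.
  obtain ⟨g, hg⟩ := LinearMap.exists_rightInverse_of_surjective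
    (T : E →ₗ[ℂ] F).range.mkQ (Submodule.range_mkQ _)
  have hg' : ∀ q, (T : E →ₗ[ℂ] F).range.mkQ (g q) = q := fun q => LinearMap.congr_fun hg q
  have hTq : ∀ x, (T : E →ₗ[ℂ] F).range.mkQ (T x) = 0 := fun x => by
    simp
  let B : (Fin N → ℂ) →L[ℂ] F := LinearMap.toContinuousLinearMap (g ∘ₗ eQ.symm.toLinearMap)
  refine ⟨N, (eK : _ →L[ℂ] _) ∘L p, B, ?_⟩
  refine ⟨ContinuousLinearEquiv.ofBijective _ ?_ ?_, ContinuousLinearEquiv.coe_ofBijective _ _ _⟩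
  · rw [LinearMap.ker_eq_bot']
    intro x hx
    replace hx : T x + g (eQ.symm (eK (p x))) = 0 := hx
    have h1 := congrArg (T : E →ₗ[ℂ] F).range.mkQ hx
    rw [map_add, hTq, hg', zero_add, map_zero] at h1
    have h2 : p x = 0 := by simpa using h1
    rw [h2] at hx
    have hxk : x ∈ (T : E →ₗ[ℂ] F).ker := by simpa using hx
    have := hp ⟨x, hxk⟩
    rw [show p ((⟨x, hxk⟩ : (T : E →ₗ[ℂ] F).ker) : E) = p x from rfl, h2] at this
    exact (congrArg Subtype.val this).symm
  · rw [LinearMap.range_eq_top]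
    intro y
    set c := (T : E →ₗ[ℂ] F).range.mkQ y with hc
    obtain ⟨x₀, hx₀⟩ : y - g c ∈ (T : E →ₗ[ℂ] F).range := by
      refine (Submodule.Quotient.mk_eq_zero _).1 ?_
      change (T : E →ₗ[ℂ] F).range.mkQ (y - g c) = 0
      rw [map_sub, hg', hc, sub_self]
    have hx₀' : T x₀ = y - g c := hx₀
    set k := eK.symm (eQ c)
    have hTk : ∀ k : (T : E →ₗ[ℂ] F).ker, T k = 0 := fun k => k.2
    -- Removing the kernel component of `x₀` does not change its image under `T`, and leaves `k` as
    -- the only part seen by the correction.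
    refine ⟨x₀ - p x₀ + k, ?_⟩
    change T _ + g (eQ.symm (eK (p _))) = y
    rw [map_add p, map_sub p, hp (p x₀), sub_self, zero_add, hp k, map_add, map_sub, hTk, hTk, hx₀']
    simp [k]

theorem analyticAt_inverse [CompleteSpace E] {A : ℂ → E →L[ℂ] F} {p : ℂ} (hA : AnalyticAt ℂ A p)
    (hp : (A p).IsInvertible) : AnalyticAt ℂ (fun z => (A z).inverse) p :=
  (hp.contDiffAt_map_inverse (n := ω)).analyticAt.comp hA

theorem eventually_isInvertible [CompleteSpace E] {X : Type*} {l : Filter X} {A : X → E →L[ℂ] F}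
    {T : E →L[ℂ] F} (hT : T.IsInvertible) (h : Tendsto A l (𝓝 T)) :
    ∀ᶠ x in l, (A x).IsInvertible := by
  obtain ⟨e, rfl⟩ := hT
  exact h.eventually e.nhds

theorem analyticAt_det {N : ℕ} {Q : ℂ → Matrix (Fin N) (Fin N) ℂ} {p : ℂ}
    (hQ : ∀ i j, AnalyticAt ℂ (fun z => Q z i j) p) : AnalyticAt ℂ (fun z => (Q z).det) p := by
  simp_rw [Matrix.det_apply']
  refine Finset.analyticAt_fun_sum _ fun τ _ => analyticAt_const.mul ?_
  exact Finset.analyticAt_fun_prod _ fun i _ => hQ _ _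

/-- If `A` is analytic at `p` with a finite rank correction, and invertible near `p` away from `p`,
then `f` has at most a pole of a fixed order `m` at `p` as soon as `A f` is regular there, and the
singular part of `f` is determined by that of a function with values in a finite-dimensional
space. -/
theorem exists_pole_order [CompleteSpace E] {A : ℂ → E →L[ℂ] F} {p : ℂ} (hA : AnalyticAt ℂ A p)
    (hinv : ∀ᶠ z in 𝓝[≠] p, (A z).IsInvertible) {N : ℕ} {C : E →L[ℂ] (Fin N → ℂ)}
    {B : (Fin N → ℂ) →L[ℂ] F} (hBC : (A p + B ∘L C).IsInvertible) :
    ∃ m : ℕ, ∀ f : ℂ → E, IsRegularAt (fun z => A z (f z)) p →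
      IsRegularAt (fun z => (z - p) ^ m • C (f z)) p ∧
      IsRegularAt (fun z => (z - p) ^ m • f z) p ∧
      (IsRegularAt (fun z => C (f z)) p → IsRegularAt f p) := by
  set R : ℂ → F →L[ℂ] E := fun z => (A z + B ∘L C).inverse with hRdef
  have hABC : AnalyticAt ℂ (fun z => A z + B ∘L C) p := hA.add analyticAt_const
  have hR : AnalyticAt ℂ R p := analyticAt_inverse hABC hBC
  have hRinv : ∀ᶠ z in 𝓝 p, (A z + B ∘L C).IsInvertible :=
    eventually_isInvertible hBC hABC.continuousAt
  have hRl : ∀ᶠ z in 𝓝 p, ∀ x, R z (A z x) + R z (B (C x)) = x := by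
    filter_upwards [hRinv] with z hz x
    have := hz.inverse_apply_self x
    rwa [add_apply, map_add] at this
  -- Applying `C` to `f = R (A f) + R (B (C f))` gives `L z (C f) = C (R (A f))`: the problem is
  -- reduced to an `N × N` system for `C f` with analytic coefficients.
  let L : ℂ → (Fin N → ℂ) →ₗ[ℂ] (Fin N → ℂ) := fun z =>
    LinearMap.id - ((C ∘L R z ∘L B : (Fin N → ℂ) →L[ℂ] (Fin N → ℂ)) : (Fin N → ℂ) →ₗ[ℂ] (Fin N → ℂ))
  have hL : ∀ z v, L z v = v - C (R z (B v)) := fun z v => rfl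
  let Q : ℂ → Matrix (Fin N) (Fin N) ℂ := fun z => LinearMap.toMatrix' (L z)
  have hQv : ∀ z v, (Q z).mulVec v = L z v := fun z v => LinearMap.toMatrix'_mulVec _ _
  have hQ : ∀ i j, AnalyticAt ℂ (fun z => Q z i j) p := by
    intro i j
    have h1 : AnalyticAt ℂ (fun z => R z (B (Pi.single j 1))) p :=
      AnalyticAt.clm_apply_of_analyticAt hR analyticAt_const
    have h2 : AnalyticAt ℂ (fun z => C (R z (B (Pi.single j 1))) i) p :=
      (((ContinuousLinearMap.proj i : (Fin N → ℂ) →L[ℂ] ℂ) ∘L C).analyticAt _).comp h1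
    have h3 : (fun z => Q z i j) =
        fun z => (Pi.single j 1 : Fin N → ℂ) i - C (R z (B (Pi.single j 1))) i := by
      ext z
      simp only [Q, LinearMap.toMatrix'_apply, hL, Pi.sub_apply]
    rw [h3]
    exact analyticAt_const.sub h2
  have hd : AnalyticAt ℂ (fun z => (Q z).det) p := analyticAt_det hQ
  -- If `v = C (R (B v))`, then `x = R (B v)` satisfies `A x + B (C x) = B v` with `C x = v`, so `A
  -- x = 0`. Where `A z` is invertible this forces `x = 0` and then `v = 0`.
  have hd0 : ∀ᶠ z in 𝓝[≠] p, (Q z).det ≠ 0 := by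
    filter_upwards [hinv, hRinv.filter_mono nhdsWithin_le_nhds] with z hz hz'
    rw [← isUnit_iff_ne_zero, ← Matrix.isUnit_iff_isUnit_det, ← Matrix.mulVec_injective_iff_isUnit,
      ← Matrix.coe_mulVecLin, ← LinearMap.ker_eq_bot, LinearMap.ker_eq_bot']
    intro v hv
    have hv' : v = C (R z (B v)) := by
      rw [Matrix.mulVecLin_apply, hQv, hL, sub_eq_zero] at hv
      exact hv
    have h1 : A z (R z (B v)) + B (C (R z (B v))) = B v := hz'.self_apply_inverse (B v)
    rw [← hv', add_eq_right] at h1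
    have h2 : R z (B v) = 0 := by
      rw [← hz.inverse_apply_self (R z (B v)), h1, map_zero]
    rw [hv', h2, map_zero]
  -- The pole order is bounded by the order of the zero of the determinant at `p`; it is finite
  -- because the determinant does not vanish near `p` away from `p`.
  obtain ⟨m, e, he, hep, hde⟩ := hd.exists_eventuallyEq_pow_smul_nonzero_iff.2 (fun h => by
    obtain ⟨z, hz, hz'⟩ := ((h.filter_mono nhdsWithin_le_nhds).and hd0).exists
    exact hz' hz)
  have key : ∀ f : ℂ → E, IsRegularAt (fun z => A z (f z)) p →
      IsRegularAt (fun z => (z - p) ^ m • C (f z)) p := by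
    intro f hf
    have hw : IsRegularAt (fun z => C (R z (A z (f z)))) p :=
      IsRegularAt.clm_apply (A := fun _ => C) analyticAt_const (hf.clm_apply hR)
    obtain ⟨w, hw, hfw⟩ := hw
    -- Cramer's rule: the adjugate inverts `Q` up to the determinant, that is, up to the factor `(z
    -- - p) ^ m` and the unit `e`.
    have hadj : AnalyticAt ℂ (fun z => (Q z).adjugate.mulVec (w z)) p := by
      rw [analyticAt_pi_iff]
      intro i
      simp only [Matrix.mulVec, dotProduct]
      refine Finset.analyticAt_fun_sum _ fun j _ => AnalyticAt.mul ?_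
        ((analyticAt_pi_iff.1 hw) j)
      simp only [Matrix.adjugate_apply]
      refine analyticAt_det fun a b => ?_
      simp only [Matrix.updateRow_apply]
      split_ifs
      · exact analyticAt_const
      · exact hQ _ _
    refine ⟨fun z => (e z)⁻¹ • (Q z).adjugate.mulVec (w z), (he.inv hep).smul hadj, ?_⟩
    filter_upwards [hfw, hRl.filter_mono nhdsWithin_le_nhds, hde.filter_mono nhdsWithin_le_nhds,
      (he.continuousAt.eventually_ne hep).filter_mono nhdsWithin_le_nhds] with z hz1 hz2 hz3 hz4
    have h1 : (Q z).mulVec (C (f z)) = w z := by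
      rw [hQv, hL, ← hz1, sub_eq_iff_eq_add, ← map_add, hz2]
    rw [← h1, Matrix.mulVec_mulVec, Matrix.adjugate_mul, hz3, Matrix.smul_mulVec, Matrix.one_mulVec,
      smul_smul, smul_eq_mul, mul_comm, mul_assoc, mul_inv_cancel₀ hz4, mul_one]
  -- By `f = R (A f) + R (B (C f))` the poles of `f` are no worse than those of `C f`. The case `k =
  -- 0` yields the last claim of the theorem.
  have key2 : ∀ f : ℂ → E, ∀ k : ℕ, IsRegularAt (fun z => A z (f z)) p →
      IsRegularAt (fun z => (z - p) ^ k • C (f z)) p →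
      IsRegularAt (fun z => (z - p) ^ k • f z) p := by
    intro f k hf hC
    have h1 : IsRegularAt (fun z => R z ((z - p) ^ k • A z (f z))) p :=
      (hf.analytic_smul ((analyticAt_id.sub analyticAt_const).pow k)).clm_apply hR
    have h2 : IsRegularAt (fun z => R z (B ((z - p) ^ k • C (f z)))) p :=
      (IsRegularAt.clm_apply (A := fun _ => B) analyticAt_const hC).clm_apply hR
    refine (h1.add h2).congr ?_
    filter_upwards [hRl.filter_mono nhdsWithin_le_nhds] with z hz
    simp only [Pi.add_apply, map_smul]
    rw [← smul_add, hz]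
  refine ⟨m, fun f hf => ⟨key f hf, key2 f m hf (key f hf), fun hC => ?_⟩⟩
  simpa using key2 f 0 hf (by simpa using hC)

/-- The hypotheses on a single operator family that make its space of singular parts
finite-dimensional. -/
structure IsFredholmOn (S : Set ℂ) (A : ℂ → E →L[ℂ] F) : Prop where
  differentiableOn : DifferentiableOn ℂ A S
  correction : ∀ p ∈ S, HasFiniteRankCorrection (A p)
  finite : (singPts S A).Finite

theorem IsFredholmOn.eventually_isInvertible {S : Set ℂ} (hS : IsOpen S) {A : ℂ → E →L[ℂ] F}
    (hA : IsFredholmOn S A) {p : ℂ} (hp : p ∈ S) : ∀ᶠ z in 𝓝[≠] p, (A z).IsInvertible := by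
  have h : (singPts S A \ {p})ᶜ ∈ 𝓝 p :=
    (hA.finite.subset sdiff_subset).isClosed.isOpen_compl.mem_nhds (by simp)
  rw [eventually_nhdsWithin_iff]
  filter_upwards [h, hS.mem_nhds hp] with z hz hzS hzp
  by_contra hcon
  exact hz ⟨⟨hzS, hcon⟩, hzp⟩

theorem isRegularAt_of_isInvertible [CompleteSpace E] {A : ℂ → E →L[ℂ] F} {p : ℂ}
    (hA : AnalyticAt ℂ A p) (hp : (A p).IsInvertible) {f : ℂ → E}
    (hf : IsRegularAt (fun z => A z (f z)) p) : IsRegularAt f p := by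
  refine (hf.clm_apply (analyticAt_inverse hA hp)).congr ?_
  filter_upwards [(KernelBundle.eventually_isInvertible hp hA.continuousAt).filter_mono
    nhdsWithin_le_nhds] with z hz
  exact hz.inverse_apply_self _

theorem IsFredholmOn.mem_polarSums [CompleteSpace E] [CompleteSpace F] {S : Set ℂ} (hS : IsOpen S)
    {A : ℂ → E →L[ℂ] F} (hA : IsFredholmOn S A) {s : ℂ → E} (hs : s ∈ kernelSpace S A) :
    s ∈ polarSums (singPts S A) E := by
  obtain ⟨hs, hr⟩ := (mem_kernelSpace_iff hS hA.differentiableOn).1 hs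
  refine mem_polarSums_of_regular hs fun p hp hpn => ?_
  refine isRegularAt_of_isInvertible (hA.differentiableOn.analyticAt (hS.mem_nhds hp)) ?_ (hr p hp)
  by_contra hcon
  exact hpn ⟨hp, hcon⟩

/-- The functions regular at `p`. -/
def regularAt (E : Type*) [NormedAddCommGroup E] [NormedSpace ℂ E] (p : ℂ) :
    Submodule ℂ (ℂ → E) where
  carrier := {f | IsRegularAt f p}
  add_mem' := IsRegularAt.add
  zero_mem' := IsRegularAt.zero p
  smul_mem' := fun c _ h => h.smul c

/-- At each of the finitely many singular points the principal part of `C p` applied to the function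
has bounded order and values in a finite-dimensional space. These principal parts together determine
the function: if all of them vanish, it is regular everywhere and therefore zero. -/
theorem IsFredholmOn.finiteDimensional_kernelSpace [CompleteSpace E] [CompleteSpace F] {S : Set ℂ}
    (hS : IsOpen S) {A : ℂ → E →L[ℂ] F} (hA : IsFredholmOn S A) :
    FiniteDimensional ℂ (kernelSpace S A) := by
  have hex : ∀ p : singPts S A, ∃ (N m : ℕ) (C : E →L[ℂ] (Fin N → ℂ)), ∀ f : ℂ → E,
      IsRegularAt (fun z => A z (f z)) p →
        IsRegularAt (fun z => (z - p) ^ m • C (f z)) p ∧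
        (IsRegularAt (fun z => C (f z)) p → IsRegularAt f p) := by
    intro p
    obtain ⟨N, C, B, hBC⟩ := hA.correction p p.2.1
    obtain ⟨m, hm⟩ := exists_pole_order (hA.differentiableOn.analyticAt (hS.mem_nhds p.2.1))
      (hA.eventually_isInvertible hS p.2.1) hBC
    exact ⟨N, m, C, fun f hf => ⟨(hm f hf).1, (hm f hf).2.2⟩⟩
  choose N m C hC using hex
  let Φ : ∀ p : singPts S A, kernelSpace S A →ₗ[ℂ] (ℂ → Fin (N p) → ℂ) ⧸ regularAt (Fin (N p) → ℂ) (p : ℂ) :=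
    fun p => (regularAt (Fin (N p) → ℂ) (p : ℂ)).mkQ ∘ₗ
      ((C p : E →ₗ[ℂ] (Fin (N p) → ℂ)).compLeft ℂ) ∘ₗ (kernelSpace S A).subtype
  -- The Laurent tails of length `m p`, modulo regular functions; their span is finite-dimensional
  -- and contains the image of `Φ p`.
  let Ψ : ∀ p : singPts S A,
      (Fin (m p) → Fin (N p) → ℂ) →ₗ[ℂ] (ℂ → Fin (N p) → ℂ) ⧸ regularAt (Fin (N p) → ℂ) (p : ℂ) :=
    fun p => (regularAt (Fin (N p) → ℂ) (p : ℂ)).mkQ ∘ₗ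
      { toFun := fun a => ∑ k : Fin (m p), fun z : ℂ => ((z - (p : ℂ)) ^ ((k : ℕ) + 1))⁻¹ • a k
        map_add' := fun a b => by
          rw [← Finset.sum_add_distrib]
          refine Finset.sum_congr rfl fun k _ => ?_
          ext z i
          simp [mul_add]
        map_smul' := fun c a => by
          rw [Finset.smul_sum]
          refine Finset.sum_congr rfl fun k _ => ?_
          ext z i
          simp [mul_left_comm] }
  have hΦΨ : ∀ p, LinearMap.range (Φ p) ≤ LinearMap.range (Ψ p) := by
    rintro p _ ⟨s, rfl⟩
    have hs := ((mem_kernelSpace_iff hS hA.differentiableOn).1 s.2).2 p p.2.1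
    obtain ⟨a, ha⟩ := exists_laurent_tail (m p) (hC p _ hs).1
    refine ⟨a, ?_⟩
    symm
    exact (Submodule.Quotient.eq _).2 ha
  have hfd : ∀ p, FiniteDimensional ℂ (LinearMap.range (Φ p)) := fun p =>
    Submodule.finiteDimensional_of_le (hΦΨ p)
  have := hA.finite.to_subtype
  let Θ : kernelSpace S A →ₗ[ℂ] ∀ p, LinearMap.range (Φ p) :=
    LinearMap.pi fun p => (Φ p).rangeRestrict
  refine FiniteDimensional.of_injective (V₂ := ∀ p, LinearMap.range (Φ p)) Θ ?_
  intro s t hst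
  have hΦ : ∀ p, Φ p (s - t) = 0 := fun p => by
    rw [map_sub, sub_eq_zero]
    exact congrArg Subtype.val (congrFun hst p)
  refine sub_eq_zero.1 (Subtype.ext ?_)
  refine eq_zero_of_mem_polarSums_of_regular (hA.mem_polarSums hS (s - t).2) fun p hp => ?_
  have hs' := ((mem_kernelSpace_iff hS hA.differentiableOn).1 (s - t).2).2 p hp.1
  exact (hC ⟨p, hp⟩ _ hs').2 ((Submodule.Quotient.mk_eq_zero _).1 (hΦ ⟨p, hp⟩))

end Fredholm

/-! ### Banach spaces of holomorphic functions and stability of the singular parts -/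

section Holo

variable {E F : Type*} [NormedAddCommGroup E] [NormedAddCommGroup F] {K : Set ℂ}

/-- The extension by zero of a continuous function on `K`. -/
def extendZero (f : C(K, E)) : ℂ → E := Function.extend Subtype.val f 0

theorem extendZero_apply (f : C(K, E)) (x : K) : extendZero f x = f x :=
  Subtype.val_injective.extend_apply f 0 x

theorem extendZero_of_mem (f : C(K, E)) {z : ℂ} (hz : z ∈ K) : extendZero f z = f ⟨z, hz⟩ :=
  extendZero_apply f ⟨z, hz⟩

theorem continuousOn_extendZero (f : C(K, E)) : ContinuousOn (extendZero f) K := by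
  rw [continuousOn_iff_continuous_domRestrict]
  convert f.continuous using 1
  ext x
  exact extendZero_apply f x

variable [NormedSpace ℂ E] [NormedSpace ℂ F]

/-- The continuous functions on `K` that are holomorphic in the interior. -/
def holo (K : Set ℂ) (E : Type*) [NormedAddCommGroup E] [NormedSpace ℂ E] : Submodule ℂ C(K, E) where
  carrier := {f | DifferentiableOn ℂ (extendZero f) (interior K)}
  add_mem' := fun {f g} hf hg => (DifferentiableOn.add hf hg).congr fun z hz => by
    simp [extendZero_of_mem _ (interior_subset hz)]
  zero_mem' := (differentiableOn_const (0 : E)).congr fun z hz => by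
    simp [extendZero_of_mem _ (interior_subset hz)]
  smul_mem' := fun c f hf => (DifferentiableOn.const_smul hf c).congr fun z hz => by
    simp [extendZero_of_mem _ (interior_subset hz)]

theorem exists_mem_holo {f : ℂ → E} (hc : ContinuousOn f K)
    (hd : DifferentiableOn ℂ f (interior K)) : ∃ g : holo K E, ∀ z ∈ K, extendZero g.1 z = f z := by
  let g : C(K, E) := ⟨K.domRestrict f, continuousOn_iff_continuous_domRestrict.1 hc⟩
  have hg : ∀ z ∈ K, extendZero g z = f z := fun z hz => extendZero_of_mem g hz
  exact ⟨⟨g, hd.congr fun z hz => hg z (interior_subset hz)⟩, hg⟩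

/-- Continuity determines the values at the exceptional points, so identities involving singular
parts need only be checked where the operators are invertible. -/
theorem holo_ext {Z : Set ℂ} (hZ : Z.Finite) (hZK : Z ⊆ interior K) {f g : holo K E}
    (h : ∀ z ∈ K, z ∉ Z → extendZero f.1 z = extendZero g.1 z) : f = g := by
  have key : ∀ z ∈ K, extendZero f.1 z = extendZero g.1 z := by
    intro z hz
    by_cases hzZ : z ∈ Z
    · have hzi := isOpen_interior.mem_nhds (hZK hzZ)
      have h1 : Tendsto (extendZero f.1) (𝓝[≠] z) (𝓝 (extendZero f.1 z)) :=
        ((f.2.differentiableAt hzi).continuousAt).mono_left nhdsWithin_le_nhds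
      have h2 : Tendsto (extendZero g.1) (𝓝[≠] z) (𝓝 (extendZero g.1 z)) :=
        ((g.2.differentiableAt hzi).continuousAt).mono_left nhdsWithin_le_nhds
      refine tendsto_nhds_unique_of_eventuallyEq h1 h2 ?_
      have h3 : (Z \ {z})ᶜ ∈ 𝓝 z :=
        (hZ.subset sdiff_subset).isClosed.isOpen_compl.mem_nhds (by simp)
      rw [EventuallyEq, eventually_nhdsWithin_iff]
      filter_upwards [h3, hzi] with w hw hwi hwz
      exact h w (interior_subset hwi) fun hwZ => hw ⟨hwZ, hwz⟩
    · exact h z hz hzZ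
  refine Subtype.ext (ContinuousMap.ext fun x => ?_)
  rw [← extendZero_apply, ← extendZero_apply, key x x.2]

/-- Removal of finitely many removable singularities in the interior of `K`. -/
theorem exists_mem_holo_of_regular {Z : Set ℂ} (hZ : Z.Finite) {f : ℂ → E}
    (hc : ∀ z ∈ K, z ∉ Z → ContinuousWithinAt f K z)
    (hd : ∀ z ∈ interior K, z ∉ Z → DifferentiableAt ℂ f z) (hr : ∀ z ∈ Z, IsRegularAt f z) :
    ∃ g : holo K E, ∀ z ∈ K, z ∉ Z → extendZero g.1 z = f z := by
  classical
  choose! G hG hfG using hr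
  let f' : ℂ → E := fun z => if z ∈ Z then G z z else f z
  have h1 : ∀ z ∉ Z, f' =ᶠ[𝓝 z] f := by
    intro z hz
    filter_upwards [hZ.isClosed.isOpen_compl.mem_nhds hz] with w hw
    exact if_neg hw
  have h2 : ∀ z ∈ Z, f' =ᶠ[𝓝 z] G z := by
    intro z hz
    have h3 : (Z \ {z})ᶜ ∈ 𝓝 z :=
      (hZ.subset sdiff_subset).isClosed.isOpen_compl.mem_nhds (by simp)
    have h4 := hfG z hz
    rw [EventuallyEq, eventually_nhdsWithin_iff] at h4
    filter_upwards [h3, h4] with w hw hw'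
    rcases eq_or_ne w z with rfl | hne
    · exact if_pos hz
    · rw [← hw' hne]
      exact if_neg fun hwZ => hw ⟨hwZ, hne⟩
  have hc' : ContinuousOn f' K := fun z hz => by
    by_cases hzZ : z ∈ Z
    · exact ((hG z hzZ).continuousAt.congr (h2 z hzZ).symm).continuousWithinAt
    · exact (hc z hz hzZ).congr_of_eventuallyEq ((h1 z hzZ).filter_mono nhdsWithin_le_nhds)
        (if_neg hzZ)
  have hd' : DifferentiableOn ℂ f' (interior K) := fun z hz => by
    by_cases hzZ : z ∈ Z
    · exact ((hG z hzZ).differentiableAt.congr_of_eventuallyEq (h2 z hzZ)).differentiableWithinAt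
    · exact ((hd z hz hzZ).congr_of_eventuallyEq (h1 z hzZ)).differentiableWithinAt
  obtain ⟨g, hg⟩ := exists_mem_holo hc' hd'
  exact ⟨g, fun z hz hzZ => (hg z hz).trans (if_neg hzZ)⟩

/-- Pointwise application of operator-valued functions. -/
def holoApply (a : holo K (E →L[ℂ] F)) (u : holo K E) : holo K F :=
  ⟨⟨fun x => a.1 x (u.1 x), a.1.continuous.clm_apply u.1.continuous⟩,
    (DifferentiableOn.clm_apply a.2 u.2).congr fun z hz => by
      simp [extendZero_of_mem _ (interior_subset hz)]⟩

theorem extendZero_holoApply (a : holo K (E →L[ℂ] F)) (u : holo K E) {z : ℂ} (hz : z ∈ K) :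
    extendZero (holoApply a u).1 z = extendZero a.1 z (extendZero u.1 z) := by
  simp only [extendZero_of_mem _ hz]
  rfl

/-! ### The supremum norm for compact `K`: completeness and multiplication -/

section Compact

variable [CompactSpace K]

/-- Weierstrass: a uniform limit of holomorphic functions is holomorphic. Completeness is what later
makes bijective bounded operators invertible. -/
theorem isClosed_holo [CompleteSpace E] : IsClosed (holo K E : Set C(K, E)) := by
  refine isSeqClosed_iff_isClosed.1 fun f g hf hfg => ?_
  have h1 : TendstoUniformly (fun n => (f n : K → E)) g atTop :=
    ContinuousMap.tendsto_iff_tendstoUniformly.1 hfg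
  have h2 : TendstoUniformlyOn (fun n => extendZero (f n)) (extendZero g) atTop (interior K) := by
    intro u hu
    filter_upwards [h1 u hu] with n hn z hz
    rw [extendZero_of_mem _ (interior_subset hz), extendZero_of_mem _ (interior_subset hz)]
    exact hn _
  exact h2.tendstoLocallyUniformlyOn.differentiableOn (Eventually.of_forall hf) isOpen_interior

instance [CompleteSpace E] : CompleteSpace (holo K E) :=
  isClosed_holo.completeSpace_coe

/-- Pointwise application as a bounded bilinear map. -/
def holoMul : holo K (E →L[ℂ] F) →L[ℂ] holo K E →L[ℂ] holo K F :=
  LinearMap.mkContinuous₂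
    (LinearMap.mk₂ ℂ holoApply
      (fun a b u => Subtype.ext (ContinuousMap.ext fun x => rfl))
      (fun c a u => Subtype.ext (ContinuousMap.ext fun x => rfl))
      (fun a u v => Subtype.ext (ContinuousMap.ext fun x => map_add (a.1 x) _ _))
      (fun c a u => Subtype.ext (ContinuousMap.ext fun x => map_smul (a.1 x) _ _))) 1
    (fun a u => by
      rw [one_mul]
      refine (ContinuousMap.norm_le _ (by positivity)).2 fun x => ?_
      exact ((a.1 x).le_opNorm _).trans
        (mul_le_mul (a.1.norm_coe_le_norm x) (u.1.norm_coe_le_norm x) (norm_nonneg _)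
          (norm_nonneg _)))

theorem holoMul_apply (a : holo K (E →L[ℂ] F)) (u : holo K E) : holoMul a u = holoApply a u := rfl

end Compact

theorem isInvertible_of_notMem {S : Set ℂ} {A : ℂ → E →L[ℂ] F} {z : ℂ} (hz : z ∈ S)
    (h : z ∉ singPts S A) : (A z).IsInvertible := by
  by_contra hcon
  exact h ⟨hz, hcon⟩

/-! ### Splitting off the singular part for a single operator family -/

section KernelEquiv

variable [CompleteSpace E] [CompleteSpace F] {S : Set ℂ} {A : ℂ → E →L[ℂ] F}

theorem exists_holo_of_mem_kernelSpace (hS : IsOpen S) (hA : IsFredholmOn S A) (hKS : K ⊆ S)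
    (s : kernelSpace S A) : ∃ h : holo K F, ∀ z ∈ K, z ∉ singPts S A → extendZero h.1 z = A z (s.1 z) := by
  have hs := hA.mem_polarSums hS s.2
  have hd : ∀ z ∈ K, z ∉ singPts S A → DifferentiableAt ℂ (fun z => A z (s.1 z)) z :=
    fun z hz hzn => (hA.differentiableOn.differentiableAt (hS.mem_nhds (hKS hz))).clm_apply
      (analyticAt_of_mem_polarSums hs hzn).differentiableAt
  exact exists_mem_holo_of_regular hA.finite
    (fun z hz hzn => (hd z hz hzn).continuousAt.continuousWithinAt)
    (fun z hz hzn => hd z (interior_subset hz) hzn)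
    (fun z hz => ((mem_kernelSpace_iff hS hA.differentiableOn).1 s.2).2 z hz.1)

/-- A kernel element and a holomorphic function that cancel are zero. -/
theorem eq_zero_of_add_eq_zero (hS : IsOpen S) (hA : IsFredholmOn S A) (hKS : K ⊆ S)
    (hK : singPts S A ⊆ interior K) {u : holo K E} {s : kernelSpace S A}
    (h : ∀ z ∈ K, z ∉ singPts S A → A z (extendZero u.1 z + s.1 z) = 0) : u = 0 ∧ s = 0 := by
  have h1 : ∀ z ∈ K, z ∉ singPts S A → extendZero u.1 z + s.1 z = 0 := by
    intro z hz hzn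
    have hinv := isInvertible_of_notMem (hKS hz) hzn
    rw [← hinv.inverse_apply_self (extendZero u.1 z + s.1 z), h z hz hzn, map_zero]
  have hs : s = 0 := by
    refine Subtype.ext (eq_zero_of_mem_polarSums_of_regular (hA.mem_polarSums hS s.2)
      fun p hp => ?_)
    have hpi := isOpen_interior.mem_nhds (hK hp)
    refine ⟨-extendZero u.1, (DifferentiableOn.analyticAt u.2 hpi).neg, ?_⟩
    have h3 : (singPts S A \ {p})ᶜ ∈ 𝓝 p :=
      (hA.finite.subset sdiff_subset).isClosed.isOpen_compl.mem_nhds (by simp)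
    rw [EventuallyEq, eventually_nhdsWithin_iff]
    filter_upwards [h3, hpi] with w hw hwi hwz
    rw [Pi.neg_apply, eq_neg_iff_add_eq_zero, add_comm]
    exact h1 w (interior_subset hwi) fun hwZ => hw ⟨hwZ, hwz⟩
  refine ⟨holo_ext hA.finite hK fun z hz hzn => ?_, hs⟩
  have := h1 z hz hzn
  rw [hs] at this
  simpa [extendZero_of_mem _ hz] using this

/-- Every holomorphic function is the image of a holomorphic function and a singular part. -/
theorem exists_add_eq (hS : IsOpen S) (hA : IsFredholmOn S A) (hKS : K ⊆ S)
    (hK : singPts S A ⊆ interior K) (h : holo K F) :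
    ∃ (u : holo K E) (s : kernelSpace S A),
      ∀ z ∈ K, z ∉ singPts S A → extendZero h.1 z = A z (extendZero u.1 z + s.1 z) := by
  -- The only candidate for `u + s` is `A⁻¹ h`; `s` will be its singular part and `u` the remainder
  -- with the singularities removed.
  set f : ℂ → E := fun z => (A z).inverse (extendZero h.1 z) with hf
  have hAf : ∀ z ∈ K, z ∉ singPts S A → A z (f z) = extendZero h.1 z := fun z hz hzn =>
    (isInvertible_of_notMem (hKS hz) hzn).self_apply_inverse _
  have han : ∀ z ∈ K, AnalyticAt ℂ A z := fun z hz =>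
    hA.differentiableOn.analyticAt (hS.mem_nhds (hKS hz))
  have hpun : ∀ p ∈ singPts S A, ∀ᶠ z in 𝓝[≠] p, z ∈ K ∧ z ∉ singPts S A := by
    intro p hp
    have h3 : (singPts S A \ {p})ᶜ ∈ 𝓝 p :=
      (hA.finite.subset sdiff_subset).isClosed.isOpen_compl.mem_nhds (by simp)
    rw [eventually_nhdsWithin_iff]
    filter_upwards [h3, isOpen_interior.mem_nhds (hK hp)] with w hw hwi hwz
    exact ⟨interior_subset hwi, fun hwZ => hw ⟨hwZ, hwz⟩⟩
  have hAfr : ∀ p ∈ singPts S A, IsRegularAt (fun z => A z (f z)) p := by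
    intro p hp
    refine (IsRegularAt.of_analyticAt (DifferentiableOn.analyticAt h.2
      (isOpen_interior.mem_nhds (hK hp)))).congr ?_
    filter_upwards [hpun p hp] with w hw
    exact (hAf w hw.1 hw.2).symm
  obtain ⟨s, hs, hsr⟩ := exists_mem_polarSums_of_finite hA.finite (f := f) (fun p hp => by
    obtain ⟨N, C, B, hBC⟩ := hA.correction p hp.1
    obtain ⟨m, hm⟩ := exists_pole_order (han p (interior_subset (hK hp)))
      (hA.eventually_isInvertible hS hp.1) hBC
    exact ⟨m, (hm f (hAfr p hp)).2.1⟩)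
  -- At a singular point `A s = A f - A (f - s)` is a difference of regular functions; elsewhere `s`
  -- itself is regular.
  have hsS : s ∈ kernelSpace S A := by
    refine (mem_kernelSpace_iff hS hA.differentiableOn).2
      ⟨polarSums_mono (fun p hp => hp.1) hs, fun p hpS => ?_⟩
    have hAp := hA.differentiableOn.analyticAt (hS.mem_nhds hpS)
    by_cases hp : p ∈ singPts S A
    · refine ((hAfr p hp).sub ((hsr p hp).clm_apply hAp)).congr (Eventually.of_forall fun z => ?_)
      simp
    · exact (IsRegularAt.of_analyticAt (analyticAt_of_mem_polarSums hs hp)).clm_apply hAp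
  have hsan : ∀ z, z ∉ singPts S A → AnalyticAt ℂ s z := fun z hz =>
    analyticAt_of_mem_polarSums hs hz
  have hinv : ∀ z ∈ K, z ∉ singPts S A → AnalyticAt ℂ (fun z => (A z).inverse) z :=
    fun z hz hzn => analyticAt_inverse (han z hz) (isInvertible_of_notMem (hKS hz) hzn)
  obtain ⟨u, hu⟩ := exists_mem_holo_of_regular (K := K) hA.finite (f := f - s)
    (fun z hz hzn => ContinuousWithinAt.sub
      ((hinv z hz hzn).continuousAt.continuousWithinAt.clm_apply (continuousOn_extendZero h.1 z hz))
      (hsan z hzn).continuousAt.continuousWithinAt)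
    (fun z hz hzn => DifferentiableAt.sub
      ((hinv z (interior_subset hz) hzn).differentiableAt.clm_apply
        (DifferentiableOn.differentiableAt h.2 (isOpen_interior.mem_nhds hz)))
      (hsan z hzn).differentiableAt) hsr
  refine ⟨u, ⟨s, hsS⟩, fun z hz hzn => ?_⟩
  rw [hu z hz hzn, Pi.sub_apply, sub_add_cancel, hAf z hz hzn]

/-- The pairs of a holomorphic function and a singular part correspond, by application of the
operator family, to the holomorphic functions with values in the target space. -/
theorem exists_kernelEquiv (hS : IsOpen S) (hA : IsFredholmOn S A) (hKS : K ⊆ S)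
    (hK : singPts S A ⊆ interior K) :
    ∃ M : (holo K E × kernelSpace S A) ≃ₗ[ℂ] holo K F, ∀ u s, ∀ z ∈ K, z ∉ singPts S A →
      extendZero (M (u, s)).1 z = A z (extendZero u.1 z + s.1 z) := by
  choose u s hus using exists_add_eq (E := E) hS hA hKS hK
  have huniq : ∀ h (u' : holo K E) (s' : kernelSpace S A),
      (∀ z ∈ K, z ∉ singPts S A → extendZero h.1 z = A z (extendZero u'.1 z + s'.1 z)) →
      (u h, s h) = (u', s') := by
    intro h u' s' h'
    have := eq_zero_of_add_eq_zero hS hA hKS hK (u := u h - u') (s := s h - s') (fun z hz hzn => by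
      have e := hus h z hz hzn
      rw [h' z hz hzn] at e
      have e2 : extendZero (u h - u').1 z + (s h - s').1 z =
          (extendZero (u h).1 z + (s h).1 z) - (extendZero u'.1 z + s'.1 z) := by
        simp only [extendZero_of_mem _ hz]
        simp
        abel
      rw [e2, map_sub, e, sub_self])
    rw [Prod.mk.injEq]
    exact ⟨sub_eq_zero.1 this.1, sub_eq_zero.1 this.2⟩
  -- The inverse is constructed first. Its values come from a choice, but uniqueness of the
  -- splitting makes the choice linear.
  let L : holo K F →ₗ[ℂ] holo K E × kernelSpace S A :=
    { toFun := fun h => (u h, s h)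
      map_add' := fun h h' => huniq _ (u h + u h') (s h + s h') fun z hz hzn => by
        have e1 := hus h z hz hzn
        have e2 := hus h' z hz hzn
        rw [extendZero_of_mem _ hz] at *
        simp only [extendZero_of_mem _ hz] at *
        simp [e1, e2]
        abel
      map_smul' := fun c h => huniq _ (c • u h) (c • s h) fun z hz hzn => by
        have e1 := hus h z hz hzn
        simp only [extendZero_of_mem _ hz] at *
        simp [e1] }
  have hbij : Function.Bijective L := by
    constructor
    · intro h h' hh
      have hh' : (u h, s h) = (u h', s h') := hh
      rw [Prod.mk.injEq] at hh'
      refine holo_ext hA.finite hK fun z hz hzn => ?_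
      rw [hus h z hz hzn, hus h' z hz hzn, hh'.1, hh'.2]
    · rintro ⟨u', s'⟩
      obtain ⟨h1, hh1⟩ := exists_holo_of_mem_kernelSpace hS hA hKS s'
      obtain ⟨h2, hh2⟩ := exists_mem_holo (K := K) (f := fun z => A z (extendZero u'.1 z))
        ((hA.differentiableOn.continuousOn.mono hKS).clm_apply (continuousOn_extendZero u'.1))
        ((hA.differentiableOn.mono (interior_subset.trans hKS)).clm_apply u'.2)
      refine ⟨h1 + h2, huniq _ _ _ fun z hz hzn => ?_⟩
      have e1 := hh1 z hz hzn
      have e2 := hh2 z hz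
      simp only [extendZero_of_mem _ hz] at *
      simp [e1, e2, add_comm]
  refine ⟨(LinearEquiv.ofBijective L hbij).symm, fun u' s' z hz hzn => ?_⟩
  set h := (LinearEquiv.ofBijective L hbij).symm (u', s') with hh
  have h1 : (u h, s h) = (u', s') := (LinearEquiv.ofBijective L hbij).apply_symm_apply (u', s')
  rw [Prod.mk.injEq] at h1
  rw [hus h z hz hzn, h1.1, h1.2]

end KernelEquiv

end Holo

/-! ### Stability of the singular parts under a change of parameter -/

section Stability

/-- The map is block triangular with the identity as one diagonal block. This transfers
invertibility between Banach space operators and families in the kernel spaces, where no topology is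
available. -/
theorem bijective_triangular_iff {R V W X : Type*} [Ring R] [AddCommGroup V] [AddCommGroup W]
    [AddCommGroup X] [Module R V] [Module R W] [Module R X] (U : X →ₗ[R] V) (L : X →ₗ[R] W) :
    Function.Bijective (fun p : V × X => (p.1 + U p.2, L p.2)) ↔ Function.Bijective L := by
  constructor
  · rintro ⟨hi, hs⟩
    refine ⟨fun x y hxy => ?_, fun w => ?_⟩
    · have : ((-U x, x) : V × X) = (-U y, y) := hi (by simp [hxy])
      exact (Prod.mk.inj this).2
    · obtain ⟨p, hp⟩ := hs (0, w)
      exact ⟨p.2, (Prod.mk.inj hp).2⟩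
  · rintro ⟨hi, hs⟩
    refine ⟨fun p q hpq => ?_, fun w => ?_⟩
    · obtain ⟨h1, h2⟩ := Prod.mk.inj hpq
      have h3 := hi h2
      rw [h3] at h1
      exact Prod.ext (add_right_cancel h1) h3
    · obtain ⟨x, hx⟩ := hs w.2
      exact ⟨(w.1 - U x, x), by simp [hx]⟩

variable {E F : Type*} [NormedAddCommGroup E] [NormedSpace ℂ E] [CompleteSpace E]
  [NormedAddCommGroup F] [NormedSpace ℂ F] [CompleteSpace F]

/-- A basis of the space of singular parts extends to nearby parameters: the singular parts of the
solutions `f` of `A z f = h j`, for suitable `h j` independent of the parameter `z`. -/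
theorem exists_stable_basis {Z : Type*} [TopologicalSpace Z] {S K : Set ℂ} (hS : IsOpen S)
    (hKc : IsCompact K) (hKS : K ⊆ S) {A : Z → ℂ → E →L[ℂ] F}
    (hcont : ContinuousOn (fun p : Z × ℂ => A p.1 p.2) (univ ×ˢ S))
    (hA : ∀ z, IsFredholmOn S (A z)) (hK : ∀ z, singPts S (A z) ⊆ interior K) (z₀ : Z) :
    ∃ (r : ℕ) (h : Fin r → holo K F) (s : ∀ z, Fin r → kernelSpace S (A z)),
      (∀ z j, ∃ u : holo K E, ∀ w ∈ K, w ∉ singPts S (A z) →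
        extendZero (h j).1 w = A z w (extendZero u.1 w + (s z j).1 w)) ∧
      ∀ᶠ z in 𝓝 z₀, Function.Bijective (Fintype.linearCombination ℂ (s z)) := by
  have : CompactSpace K := isCompact_iff_compactSpace.1 hKc
  choose M hM using fun z => exists_kernelEquiv hS (hA z) hKS (hK z)
  choose a ha using fun z => exists_mem_holo (K := K) (f := A z)
    ((hA z).differentiableOn.continuousOn.mono hKS)
    ((hA z).differentiableOn.mono (interior_subset.trans hKS))
  -- On compact `K` uniform convergence is the compact-open topology, so joint continuity of `A`
  -- makes `z ↦ A z` continuous in the supremum norm.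
  have hac : Continuous a := by
    rw [continuous_induced_rng]
    refine ContinuousMap.continuous_of_continuous_uncurry _ ?_
    have h1 : Continuous (fun p : Z × K => A p.1 p.2) :=
      hcont.comp_continuous (f := fun p : Z × K => (p.1, (p.2 : ℂ)))
        (continuous_fst.prodMk (continuous_subtype_val.comp continuous_snd))
        (fun p => ⟨mem_univ _, hKS p.2.2⟩)
    refine h1.congr fun p => ?_
    rw [← ha p.1 p.2 p.2.2, extendZero_apply]
    rfl
  have hMa : ∀ z u, M z (u, 0) = holoMul (a z) u := by
    intro z u
    refine holo_ext (hA z).finite (hK z) fun w hw hwn => ?_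
    rw [hM z u 0 w hw hwn, holoMul_apply, extendZero_holoApply _ _ hw, ha z w hw]
    simp
  have := (hA z₀).finiteDimensional_kernelSpace hS
  let b := Module.finBasis ℂ (kernelSpace S (A z₀))
  let r := Module.finrank ℂ (kernelSpace S (A z₀))
  -- The right-hand sides are frozen at `z₀`; only the solutions, hence their singular parts, move
  -- with `z`.
  let h : Fin r → holo K F := fun j => M z₀ (0, b j)
  let s : ∀ z, Fin r → kernelSpace S (A z) := fun z j => ((M z).symm (h j)).2
  let u : ∀ z, Fin r → holo K E := fun z j => ((M z).symm (h j)).1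
  -- Source and target do not depend on `z`, and `z` enters only through multiplication by `a z`, so
  -- `T` is norm continuous.
  let T : Z → (holo K E × (Fin r → ℂ)) →L[ℂ] holo K F := fun z =>
    (holoMul (a z)).coprod (LinearMap.toContinuousLinearMap (Fintype.linearCombination ℂ h))
  have hT : ∀ z, Function.Bijective (T z) ↔
      Function.Bijective (Fintype.linearCombination ℂ (s z)) := by
    intro z
    rw [← bijective_triangular_iff (Fintype.linearCombination ℂ (u z)),
      ← ((M z).symm.bijective.of_comp_iff' (T z))]
    -- In the splitting of `holo K F` given by `M z`, the first summand of the source is mapped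
    -- identically, and the `h j` are replaced by the pairs `(u z j, s z j)`.
    have e : (M z).symm ∘ T z = fun p : holo K E × (Fin r → ℂ) =>
        (p.1 + Fintype.linearCombination ℂ (u z) p.2, Fintype.linearCombination ℂ (s z) p.2) := by
      ext1 p
      have e1 : T z p = M z (p.1, 0) + ∑ j, p.2 j • h j := by
        rw [hMa]
        simp [T, Fintype.linearCombination_apply]
      rw [Function.comp_apply, e1, map_add, LinearEquiv.symm_apply_apply, map_sum]
      simp only [map_smul, Fintype.linearCombination_apply]
      refine Prod.ext ?_ ?_
      · simp [u, Prod.fst_sum]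
      · simp [s, Prod.snd_sum]
    rw [e]
  refine ⟨r, h, s, fun z j => ⟨u z j, fun w hw hwn => ?_⟩, ?_⟩
  · rw [← hM z (u z j) (s z j) w hw hwn]
    simp [u, s]
  have hs₀ : s z₀ = b := by
    ext1 j
    simp [s, h]
  have hb₀ : Function.Bijective (T z₀) := by
    rw [hT, hs₀]
    have : ⇑(Fintype.linearCombination ℂ b) = b.equivFun.symm := by
      ext1 c
      rw [Module.Basis.equivFun_symm_apply, Fintype.linearCombination_apply]
    rw [this]
    exact b.equivFun.symm.bijective
  have hinv₀ : (T z₀).IsInvertible := by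
    exact ⟨ContinuousLinearEquiv.ofBijective (T z₀) (LinearMap.ker_eq_bot.2 hb₀.1)
      (LinearMap.range_eq_top.2 hb₀.2), ContinuousLinearEquiv.coe_ofBijective _ _ _⟩
  have hTc : Continuous T := by
    have h1 : Continuous fun z => holoMul (F := F) (E := E) (a z) := holoMul.continuous.comp hac
    exact h1.continuousLinearMapCoprod continuous_const
  filter_upwards [eventually_isInvertible hinv₀ hTc.continuousAt] with z hz
  rw [← hT]
  obtain ⟨e, he⟩ := hz
  rw [← he]
  exact e.bijective

end Stability

/-! ### Smooth dependence of integrals on parameters -/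

section Parametric

universe u

theorem hasFDerivAt_intervalIntegral_of_contDiffOn {X : Type*} [NormedAddCommGroup X]
    [NormedSpace ℝ X] {E : Type*} [NormedAddCommGroup E] [NormedSpace ℝ E]
    {f : X × ℝ → E} {G : Set (X × ℝ)} (hG : IsOpen G) (hf : ContDiffOn ℝ 1 f G) {a b : ℝ} {x₀ : X}
    (h : ∀ t ∈ uIcc a b, (x₀, t) ∈ G) :
    HasFDerivAt (fun x => ∫ t in a..b, f (x, t))
      (∫ t in a..b, (fderiv ℝ f (x₀, t)) ∘L ContinuousLinearMap.inl ℝ X ℝ) x₀ := by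
  have hf' : ContinuousOn (fun p => (fderiv ℝ f p) ∘L ContinuousLinearMap.inl ℝ X ℝ) G :=
    (hf.continuousOn_fderiv_of_isOpen hG le_rfl).clm_comp continuousOn_const
  have hline : ∀ x : X, Continuous fun t : ℝ => (x, t) := fun x => by fun_prop
  obtain ⟨C, hC⟩ := isCompact_uIcc.exists_bound_of_continuousOn
    (hf'.comp (hline x₀).continuousOn h)
  -- The derivative in `x` is bounded by `C + 1` on this open set. A tube around `{x₀} × [a, b]`
  -- inside it makes the constant a dominating function.
  let O : Set (X × ℝ) := G ∩ {p | ‖(fderiv ℝ f p) ∘L ContinuousLinearMap.inl ℝ X ℝ‖ < C + 1}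
  have hO : IsOpen O := hf'.norm.isOpen_inter_preimage hG isOpen_Iio
  obtain ⟨U, V, hU, hV, hxU, hV', hUV⟩ := generalized_tube_lemma (isCompact_singleton (x := x₀))
    (isCompact_uIcc (a := a) (b := b)) hO (by
      rintro ⟨x, t⟩ ⟨hx, ht⟩
      obtain rfl : x = x₀ := hx
      exact ⟨h t ht, (hC t ht).trans_lt (lt_add_one C)⟩)
  have hUn : U ∈ 𝓝 x₀ := hU.mem_nhds (hxU rfl)
  have hGU : ∀ x ∈ U, ∀ t ∈ uIcc a b, (x, t) ∈ O := fun x hx t ht => hUV ⟨hx, hV' ht⟩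
  have hcont : ∀ x ∈ U, ContinuousOn (fun t => f (x, t)) (uIcc a b) := fun x hx =>
    hf.continuousOn.comp (hline x).continuousOn fun t ht => (hGU x hx t ht).1
  refine intervalIntegral.hasFDerivAt_integral_of_dominated_of_fderiv_le
    (F := fun x t => f (x, t))
    (F' := fun x t => (fderiv ℝ f (x, t)) ∘L ContinuousLinearMap.inl ℝ X ℝ)
    (bound := fun _ => C + 1) hUn ?_ ((hcont x₀ (hxU rfl)).intervalIntegrable) ?_ ?_
    intervalIntegrable_const ?_
  · filter_upwards [hUn] with x hx using
      ((hcont x hx).mono uIoc_subset_uIcc).aestronglyMeasurable measurableSet_uIoc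
  · exact ((hf'.comp (hline x₀).continuousOn h).mono
      uIoc_subset_uIcc).aestronglyMeasurable measurableSet_uIoc
  · refine Eventually.of_forall fun t ht x hx => ?_
    exact (hGU x hx t (uIoc_subset_uIcc ht)).2.le
  · refine Eventually.of_forall fun t ht x hx => ?_
    have h1 := (hf.contDiffAt (hG.mem_nhds (hGU x hx t (uIoc_subset_uIcc ht)).1)).differentiableAt
      one_ne_zero
    exact h1.hasFDerivAt.comp x (hasFDerivAt_prodMk_left x t)

/-- Repeated differentiation under the integral. The target is quantified after `n` because the
induction passes from `E` to `X →L[ℝ] E`; taking `X` in `Type` keeps that space in the same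
universe. -/
theorem contDiffOn_nat_intervalIntegral {X : Type} [NormedAddCommGroup X] [NormedSpace ℝ X]
    {a b : ℝ} {W : Set X} (hW : IsOpen W) {G : Set (X × ℝ)} (hG : IsOpen G)
    (h : ∀ x ∈ W, ∀ t ∈ uIcc a b, (x, t) ∈ G) (n : ℕ) :
    ∀ {E : Type u} [NormedAddCommGroup E] [NormedSpace ℝ E] {f : X × ℝ → E},
      ContDiffOn ℝ ∞ f G → ContDiffOn ℝ n (fun x => ∫ t in a..b, f (x, t)) W := by
  induction n with
  | zero =>
    intro E _ _ f hf
    refine contDiffOn_zero.2 fun x hx => ?_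
    exact (hasFDerivAt_intervalIntegral_of_contDiffOn hG (hf.of_le (by simp))
      (h x hx)).continuousAt.continuousWithinAt
  | succ n ih =>
    intro E _ _ f hf
    have hd : ∀ x ∈ W, HasFDerivAt (fun x => ∫ t in a..b, f (x, t))
        (∫ t in a..b, (fderiv ℝ f (x, t)) ∘L ContinuousLinearMap.inl ℝ X ℝ) x := fun x hx =>
      hasFDerivAt_intervalIntegral_of_contDiffOn hG (hf.of_le (by simp)) (h x hx)
    push_cast
    rw [contDiffOn_succ_iff_fderiv_of_isOpen hW]
    refine ⟨fun x hx => (hd x hx).differentiableAt.differentiableWithinAt, by simp, ?_⟩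
    refine (ih (f := fun p => (fderiv ℝ f p) ∘L ContinuousLinearMap.inl ℝ X ℝ) ?_).congr
      fun x hx => (hd x hx).fderiv
    exact (hf.fderiv_of_isOpen hG (by simp)).clm_comp contDiffOn_const

theorem contDiffAt_circleIntegral {X : Type} [NormedAddCommGroup X] [NormedSpace ℝ X]
    {E : Type*} [NormedAddCommGroup E] [NormedSpace ℂ E] {f : X × ℂ → E} {G : Set (X × ℂ)}
    (hG : IsOpen G) (hf : ContDiffOn ℝ ∞ f G) {c : ℂ} {R : ℝ} (hR : 0 ≤ R) {x₀ : X}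
    (h : ∀ ζ ∈ Metric.sphere c R, (x₀, ζ) ∈ G) :
    ContDiffAt ℝ ∞ (fun x => ∮ ζ in C(c, R), f (x, ζ)) x₀ := by
  obtain ⟨U, V, hU, hV, hxU, hV', hUV⟩ := generalized_tube_lemma (isCompact_singleton (x := x₀))
    (isCompact_sphere c R) hG (by
      rintro ⟨x, t⟩ ⟨hx, ht⟩
      obtain rfl : x = x₀ := hx
      exact h t ht)
  have hcm : ContDiff ℝ ∞ (circleMap c R) := contDiff_circleMap c R
  let Φ : X × ℝ → X × ℂ := fun p => (p.1, circleMap c R p.2)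
  have hΦ : ContDiff ℝ ∞ Φ := contDiff_fst.prodMk (hcm.comp contDiff_snd)
  have hG' : IsOpen (Φ ⁻¹' G) := hG.preimage hΦ.continuous
  have hdc : ContDiff ℝ ∞ (fun p : X × ℝ => deriv (circleMap c R) p.2) := by
    simp only [deriv_circleMap]
    exact ((contDiff_circleMap 0 R).comp contDiff_snd).mul contDiff_const
  have hf' : ContDiffOn ℝ ∞ (fun p : X × ℝ => deriv (circleMap c R) p.2 • f (Φ p)) (Φ ⁻¹' G) :=
    hdc.contDiffOn.smul (hf.comp hΦ.contDiffOn fun p hp => hp)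
  have key : ContDiffOn ℝ ∞ (fun x => ∮ ζ in C(c, R), f (x, ζ)) U := by
    rw [contDiffOn_infty]
    intro n
    exact contDiffOn_nat_intervalIntegral hU hG'
      (fun x hx t _ => hUV ⟨hx, hV' (circleMap_mem_sphere c hR t)⟩) n hf'
  exact key.contDiffAt (hU.mem_nhds (hxU rfl))

theorem contMDiffAt_circleIntegral {X : Type} [NormedAddCommGroup X] [NormedSpace ℝ X]
    {H : Type*} [TopologicalSpace H] {I : ModelWithCorners ℝ X H} [I.Boundaryless]
    {M : Type*} [TopologicalSpace M] [ChartedSpace H M] [IsManifold I ∞ M]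
    {E : Type*} [NormedAddCommGroup E] [NormedSpace ℂ E] {f : M × ℂ → E} {G : Set (M × ℂ)}
    (hG : IsOpen G) (hf : ContMDiffOn (I.prod 𝓘(ℝ, ℂ)) 𝓘(ℝ, E) ∞ f G) {c : ℂ} {R : ℝ}
    (hR : 0 ≤ R) {x₀ : M} (h : ∀ ζ ∈ Metric.sphere c R, (x₀, ζ) ∈ G) :
    ContMDiffAt I 𝓘(ℝ, E) ∞ (fun x => ∮ ζ in C(c, R), f (x, ζ)) x₀ := by
  set φ := extChartAt I x₀ with hφ
  have hT : IsOpen φ.target := isOpen_extChartAt_target x₀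
  let Ψ : X × ℂ → M × ℂ := fun p => (φ.symm p.1, p.2)
  have hΨ : ContMDiffOn 𝓘(ℝ, X × ℂ) (I.prod 𝓘(ℝ, ℂ)) ∞ Ψ (φ.target ×ˢ univ) := by
    have h1 : ContMDiffOn 𝓘(ℝ, X × ℂ) I ∞ (fun p : X × ℂ => φ.symm p.1) (φ.target ×ˢ univ) :=
      (contMDiffOn_extChartAt_symm x₀).comp (contDiff_fst.contMDiff.contMDiffOn)
        fun p hp => hp.1
    exact h1.prodMk contDiff_snd.contMDiff.contMDiffOn
  let G' := (φ.target ×ˢ univ) ∩ Ψ ⁻¹' G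
  have hG' : IsOpen G' := hΨ.continuousOn.isOpen_inter_preimage (hT.prod isOpen_univ) hG
  have hf' : ContDiffOn ℝ ∞ (f ∘ Ψ) G' :=
    contMDiffOn_iff_contDiffOn.1 (hf.comp (hΨ.mono inter_subset_left) fun p hp => hp.2)
  have hx : φ.symm (φ x₀) = x₀ := extChartAt_to_inv x₀
  have key := contDiffAt_circleIntegral hG' hf' hR (x₀ := φ x₀) (c := c) (fun ζ hζ =>
    ⟨⟨mem_extChartAt_target x₀, mem_univ _⟩, by simpa [Ψ, hx] using h ζ hζ⟩)
  have h2 : ContMDiffAt I 𝓘(ℝ, X) ∞ φ x₀ := contMDiffAt_extChartAt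
  refine (key.contMDiffAt.comp x₀ h2).congr_of_eventuallyEq ?_
  filter_upwards [extChartAt_source_mem_nhds (I := I) x₀] with x hx
  simp only [Function.comp_apply, Ψ]
  rw [φ.left_inv hx]

end Parametric

/-! ### Cauchy's formula for polar sums -/

section Cauchy

variable {E : Type*} [NormedAddCommGroup E] [NormedSpace ℂ E]

/-- Partial fractions, from `(σ - ζ) + (ζ - p) = σ - p`, lower the order of the pole at `p` by one.
Of the remaining terms, `(σ - ζ)⁻¹` is holomorphic in the disc, and powers `(ζ - p)⁻ᵐ` with `m ≥ 2`
have primitives. -/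
theorem circleIntegral_inv_sub_mul_pow {c p σ : ℂ} {R : ℝ} (hp : p ∈ Metric.ball c R)
    (hσ : σ ∉ Metric.closedBall c R) (k : ℕ) :
    (∮ ζ in C(c, R), (σ - ζ)⁻¹ * ((ζ - p) ^ (k + 1))⁻¹) =
      2 * Real.pi * Complex.I * ((σ - p) ^ (k + 1))⁻¹ := by
  have hR : 0 ≤ R := (Metric.pos_of_mem_ball hp).le
  have hσp : σ - p ≠ 0 := sub_ne_zero.2 fun h => hσ (h ▸ Metric.ball_subset_closedBall hp)
  have hζσ : ∀ ζ ∈ Metric.closedBall c R, σ - ζ ≠ 0 := fun ζ hζ =>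
    sub_ne_zero.2 fun h => hσ (h ▸ hζ)
  have hζp : ∀ ζ ∈ Metric.sphere c R, ζ - p ≠ 0 := fun ζ hζ => sub_ne_zero.2 fun h => by
    rw [h] at hζ
    exact (Metric.mem_ball.1 hp).ne (Metric.mem_sphere.1 hζ)
  have hc1 : ContinuousOn (fun ζ => (σ - ζ)⁻¹) (Metric.sphere c R) :=
    (continuousOn_const.sub continuousOn_id).inv₀ fun ζ hζ =>
      hζσ ζ (Metric.sphere_subset_closedBall hζ)
  have hc2 : ∀ m : ℕ, ContinuousOn (fun ζ => ((ζ - p) ^ m)⁻¹) (Metric.sphere c R) := fun m =>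
    ((continuousOn_id.sub continuousOn_const).pow m).inv₀ fun ζ hζ => pow_ne_zero _ (hζp ζ hζ)
  have h0 : (∮ ζ in C(c, R), (σ - ζ)⁻¹) = 0 :=
    Complex.circleIntegral_eq_zero_of_differentiable_on_off_countable hR countable_empty
      ((continuousOn_const.sub continuousOn_id).inv₀ hζσ) fun z hz =>
      ((differentiableAt_const σ).sub differentiableAt_id).inv
        (hζσ z (Metric.ball_subset_closedBall hz.1))
  induction k with
  | zero =>
    have e : (∮ ζ in C(c, R), (σ - ζ)⁻¹ * ((ζ - p) ^ (0 + 1))⁻¹) =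
        ∮ ζ in C(c, R), (σ - p)⁻¹ • ((ζ - p)⁻¹ + (σ - ζ)⁻¹) := by
      refine circleIntegral.integral_congr hR fun ζ hζ => ?_
      have h1 := hζp ζ hζ
      have h2 := hζσ ζ (Metric.sphere_subset_closedBall hζ)
      simp only [zero_add, pow_one, smul_eq_mul]
      field_simp
      ring
    rw [e, circleIntegral.integral_smul, circleIntegral.integral_add, h0,
      circleIntegral.integral_sub_inv_of_mem_ball hp]
    · simp [mul_comm]
    · simpa using (hc2 1).circleIntegrable hR
    · exact hc1.circleIntegrable hR
  | succ k ih =>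
    have e : (∮ ζ in C(c, R), (σ - ζ)⁻¹ * ((ζ - p) ^ (k + 1 + 1))⁻¹) =
        ∮ ζ in C(c, R), (σ - p)⁻¹ • (((ζ - p) ^ (k + 2))⁻¹ + (σ - ζ)⁻¹ * ((ζ - p) ^ (k + 1))⁻¹) := by
      refine circleIntegral.integral_congr hR fun ζ hζ => ?_
      have h1 := hζp ζ hζ
      have h2 := hζσ ζ (Metric.sphere_subset_closedBall hζ)
      simp only [smul_eq_mul]
      field_simp
      ring
    have hz : (∮ ζ in C(c, R), ((ζ - p) ^ (k + 2))⁻¹) = 0 := by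
      have := circleIntegral.integral_sub_zpow_of_ne (n := -((k + 2 : ℕ) : ℤ)) (by omega) c p R
      simpa only [zpow_neg, zpow_natCast] using this
    rw [e, circleIntegral.integral_smul, circleIntegral.integral_add, hz, ih]
    · rw [smul_eq_mul, zero_add, pow_succ (σ - p) (k + 1), mul_inv]
      ring
    · exact (hc2 _).circleIntegrable hR
    · exact (hc1.mul (hc2 _)).circleIntegrable hR

theorem continuousOn_inv_sub {c σ : ℂ} {R : ℝ} (hσ : σ ∉ Metric.closedBall c R) :
    ContinuousOn (fun ζ => (σ - ζ)⁻¹) (Metric.closedBall c R) :=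
  (continuousOn_const.sub continuousOn_id).inv₀ fun ζ hζ => sub_ne_zero.2 fun h : σ = ζ => hσ (h ▸ hζ)

theorem circleIntegral_inv_sub_smul_eq_zero {c σ : ℂ} {R : ℝ} (hR : 0 ≤ R)
    (hσ : σ ∉ Metric.closedBall c R) {u : ℂ → E}
    (hu : ∀ z ∈ Metric.closedBall c R, DifferentiableAt ℂ u z) :
    (∮ ζ in C(c, R), (σ - ζ)⁻¹ • u ζ) = 0 :=
  Complex.circleIntegral_eq_zero_of_differentiable_on_off_countable hR countable_empty
    ((continuousOn_inv_sub hσ).smul fun z hz => (hu z hz).continuousAt.continuousWithinAt)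
    fun z hz => (((differentiableAt_const σ).sub differentiableAt_id).inv
      (sub_ne_zero.2 fun h : σ = z => hσ (h ▸ Metric.ball_subset_closedBall hz.1))).smul
        (hu z (Metric.ball_subset_closedBall hz.1))

variable [CompleteSpace E]

/-- Cauchy's formula for the exterior of a finite union of discs that contains all poles. -/
theorem eq_sum_circleIntegral_of_mem_polarSums {Z : Finset ℂ} {δ : ℝ} (hδ : 0 ≤ δ)
    (hZ : ∀ q ∈ Z, ∀ q' ∈ Z, q ≠ q' →
      Disjoint (Metric.closedBall q δ) (Metric.closedBall q' δ))
    {s : ℂ → E} (hs : s ∈ polarSums (⋃ q ∈ Z, Metric.ball q δ) E) {σ : ℂ}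
    (hσ : ∀ q ∈ Z, σ ∉ Metric.closedBall q δ) :
    (∀ q ∈ Z, ContinuousOn s (Metric.sphere q δ)) ∧
    s σ = ∑ q ∈ Z, (2 * Real.pi * Complex.I : ℂ)⁻¹ • ∮ ζ in C(q, δ), (σ - ζ)⁻¹ • s ζ := by
  have hcσ : ∀ q ∈ Z, ContinuousOn (fun ζ => (σ - ζ)⁻¹) (Metric.sphere q δ) := fun q hq =>
    (continuousOn_inv_sub (hσ q hq)).mono Metric.sphere_subset_closedBall
  -- Continuity on the circles is carried along because additivity of contour integrals requires
  -- integrability.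
  induction hs using Submodule.span_induction with
  | mem s h =>
    obtain ⟨p, hp, k, a, rfl⟩ := h
    obtain ⟨q₀, hq₀, hp⟩ := mem_iUnion₂.1 hp
    have hd : ∀ ζ, ζ ≠ p → DifferentiableAt ℂ (fun ζ => ((ζ - p) ^ (k + 1))⁻¹ • a) ζ :=
      fun ζ hζ => ((((differentiableAt_id).sub (differentiableAt_const p)).pow (k + 1)).inv
        (pow_ne_zero _ (sub_ne_zero.2 hζ))).smul (differentiableAt_const a)
    have hne : ∀ q ∈ Z, q ≠ q₀ → ∀ ζ ∈ Metric.closedBall q δ, ζ ≠ p := by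
      rintro q hq hqq ζ hζ rfl
      exact (hZ q hq q₀ hq₀ hqq).le_bot ⟨hζ, Metric.ball_subset_closedBall hp⟩
    refine ⟨fun q hq ζ hζ => (hd ζ ?_).continuousAt.continuousWithinAt, ?_⟩
    · rcases eq_or_ne q q₀ with rfl | hqq
      · rintro rfl
        exact (Metric.mem_ball.1 hp).ne (Metric.mem_sphere.1 hζ)
      · exact hne q hq hqq ζ (Metric.sphere_subset_closedBall hζ)
    -- Only the disc containing the pole contributes; over the other discs the integrand is
    -- holomorphic.
    · rw [Finset.sum_eq_single_of_mem q₀ hq₀]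
      · simp_rw [smul_smul]
        rw [circleIntegral.integral_smul_const, circleIntegral_inv_sub_mul_pow hp (hσ q₀ hq₀),
          smul_smul, inv_mul_cancel_left₀ Complex.two_pi_I_ne_zero]
      · intro q hq hqq
        rw [circleIntegral_inv_sub_smul_eq_zero hδ (hσ q hq)
          (fun z hz => hd z (hne q hq hqq z hz)), smul_zero]
  | zero => exact ⟨fun q _ => continuousOn_const, by simp [circleIntegral]⟩
  | add s t _ _ h₁ h₂ =>
    refine ⟨fun q hq => (h₁.1 q hq).add (h₂.1 q hq), ?_⟩
    rw [Pi.add_apply, h₁.2, h₂.2, ← Finset.sum_add_distrib]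
    refine Finset.sum_congr rfl fun q hq => ?_
    rw [← smul_add, ← circleIntegral.integral_add]
    · simp_rw [Pi.add_apply, smul_add]
    · exact ((hcσ q hq).smul (h₁.1 q hq)).circleIntegrable hδ
    · exact ((hcσ q hq).smul (h₂.1 q hq)).circleIntegrable hδ
  | smul c s _ h =>
    refine ⟨fun q hq => (h.1 q hq).const_smul c, ?_⟩
    rw [Pi.smul_apply, h.2, Finset.smul_sum]
    refine Finset.sum_congr rfl fun q hq => ?_
    rw [smul_comm c, ← circleIntegral.integral_smul]
    simp_rw [Pi.smul_apply, smul_comm _ c]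

/-- The singular part of `f` is a sum of contour integrals of `f`. -/
theorem eq_sum_circleIntegral {Z : Finset ℂ} {δ : ℝ} (hδ : 0 ≤ δ)
    (hZ : ∀ q ∈ Z, ∀ q' ∈ Z, q ≠ q' →
      Disjoint (Metric.closedBall q δ) (Metric.closedBall q' δ))
    {s u f : ℂ → E} (hs : s ∈ polarSums (⋃ q ∈ Z, Metric.ball q δ) E)
    (hu : ∀ q ∈ Z, ∀ z ∈ Metric.closedBall q δ, DifferentiableAt ℂ u z)
    (hf : ∀ q ∈ Z, ∀ z ∈ Metric.sphere q δ, f z = u z + s z) {σ : ℂ}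
    (hσ : ∀ q ∈ Z, σ ∉ Metric.closedBall q δ) :
    s σ = ∑ q ∈ Z, (2 * Real.pi * Complex.I : ℂ)⁻¹ • ∮ ζ in C(q, δ), (σ - ζ)⁻¹ • f ζ := by
  obtain ⟨hc, he⟩ := eq_sum_circleIntegral_of_mem_polarSums hδ hZ hs hσ
  rw [he]
  refine Finset.sum_congr rfl fun q hq => ?_
  congr 1
  have hcσ := continuousOn_inv_sub (hσ q hq)
  have e : (∮ ζ in C(q, δ), (σ - ζ)⁻¹ • f ζ) =
      ∮ ζ in C(q, δ), ((σ - ζ)⁻¹ • u ζ + (σ - ζ)⁻¹ • s ζ) :=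
    circleIntegral.integral_congr hδ fun ζ hζ => by
      rw [hf q hq ζ hζ, smul_add]
  rw [e, circleIntegral.integral_add, circleIntegral_inv_sub_smul_eq_zero hδ (hσ q hq) (hu q hq),
    zero_add]
  · refine ContinuousOn.circleIntegrable hδ ?_
    exact (hcσ.smul fun z hz => (hu q hq z hz).continuousAt.continuousWithinAt).mono
      Metric.sphere_subset_closedBall
  · exact ((hcσ.mono Metric.sphere_subset_closedBall).smul (hc q hq)).circleIntegrable hδ

end Cauchy

/-! ### Smooth operations on functions with values in complex normed spaces -/

section Smooth

variable {X : Type*} [NormedAddCommGroup X] [NormedSpace ℝ X] {H : Type*} [TopologicalSpace H]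
  {I : ModelWithCorners ℝ X H} {M : Type*} [TopologicalSpace M] [ChartedSpace H M]
  {E F : Type*} [NormedAddCommGroup E] [NormedSpace ℂ E] [NormedAddCommGroup F] [NormedSpace ℂ F]

/-- The base is a real manifold and the values are complex: the operation is smooth over `ℂ`, and
its smoothness is restricted to `ℝ` before composition. -/
theorem contMDiffAt_complex_smul {c : M → ℂ} {v : M → E} {x : M}
    (hc : ContMDiffAt I 𝓘(ℝ, ℂ) ∞ c x) (hv : ContMDiffAt I 𝓘(ℝ, E) ∞ v x) :
    ContMDiffAt I 𝓘(ℝ, E) ∞ (fun x => c x • v x) x := by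
  have h : ContDiff ℝ ∞ (fun p : ℂ × E => p.1 • p.2) :=
    (contDiff_smul (𝕜 := ℂ)).restrict_scalars ℝ
  exact h.contDiffAt.comp_contMDiffAt (hc.prodMk_space hv)

theorem contMDiffAt_complex_clm_apply {T : M → E →L[ℂ] F} {v : M → E} {x : M}
    (hT : ContMDiffAt I 𝓘(ℝ, E →L[ℂ] F) ∞ T x) (hv : ContMDiffAt I 𝓘(ℝ, E) ∞ v x) :
    ContMDiffAt I 𝓘(ℝ, F) ∞ (fun x => T x (v x)) x := by
  have h : ContDiff ℝ ∞ (fun p : (E →L[ℂ] F) × E => p.1 p.2) :=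
    (isBoundedBilinearMap_apply (𝕜 := ℂ)).contDiff.restrict_scalars ℝ
  exact h.contDiffAt.comp_contMDiffAt (hT.prodMk_space hv)

theorem contMDiffAt_clm_inverse [CompleteSpace E] {T : M → E →L[ℂ] F} {x : M}
    (hT : ContMDiffAt I 𝓘(ℝ, E →L[ℂ] F) ∞ T x) (hx : (T x).IsInvertible) :
    ContMDiffAt I 𝓘(ℝ, F →L[ℂ] E) ∞ (fun x => (T x).inverse) x :=
  ((hx.contDiffAt_map_inverse (n := ∞)).restrict_scalars ℝ).comp_contMDiffAt hT

theorem contMDiffAt_const_clm_apply (L : E →L[ℂ] F) {v : M → E} {x : M}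
    (hv : ContMDiffAt I 𝓘(ℝ, E) ∞ v x) : ContMDiffAt I 𝓘(ℝ, F) ∞ (fun x => L (v x)) x :=
  (L.contDiff.restrict_scalars ℝ).contDiffAt.comp_contMDiffAt hv

end Smooth

/-! ### Coefficients of a combination of functions that depend on a parameter -/

section Coefficients

variable {E : Type*} [NormedAddCommGroup E] [NormedSpace ℂ E]

/-- Linearly independent functions on a set are separated by finitely many evaluations. -/
theorem exists_separating_evaluations {α : Type*} {r : ℕ} {f : Fin r → α → E}
    (hf : LinearIndependent ℂ f) :
    ∃ (N : ℕ) (σ : Fin N → α) (l : Fin N → E →L[ℂ] ℂ),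
      ∀ c : Fin r → ℂ, (∀ k, l k (∑ j, c j • f j (σ k)) = 0) → c = 0 := by
  let g : Fin r → α × (E →L[ℂ] ℂ) → ℂ := fun j p => p.2 (f j p.1)
  have hg : LinearIndependent ℂ g := by
    rw [Fintype.linearIndependent_iff] at hf ⊢
    intro c hc
    refine hf c ?_
    ext1 a
    by_contra hne
    obtain ⟨l, hl⟩ := SeparatingDual.exists_ne_zero (R := ℂ) hne
    refine hl ?_
    have := congrFun hc (a, l)
    simpa [g, Finset.sum_apply] using this
  -- Row rank equals column rank: the vectors of values of the `g j` at single pairs `(a, l)` span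
  -- `ℂʳ`, so finitely many of them already do.
  have hspan := span_flip_eq_top_iff_linearIndependent.2 hg
  obtain ⟨w, hw, hws, -⟩ := Submodule.exists_fun_fin_finrank_span_eq ℂ (range (flip g))
  choose p hp using hw
  refine ⟨_, fun k => (p k).1, fun k => (p k).2, fun c hc => ?_⟩
  let φ : (Fin r → ℂ) →ₗ[ℂ] ℂ := Fintype.linearCombination ℂ c
  have hφ : φ = 0 := by
    refine LinearMap.ext_on_range (v := w) (hws.trans hspan) fun k => ?_
    rw [← hp k]
    have := hc k
    simp only [map_sum, map_smul] at this
    simpa [φ, Fintype.linearCombination_apply, flip, g, mul_comm] using this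
  ext i
  have := LinearMap.congr_fun hφ (Pi.single i 1)
  simpa [φ] using this

variable {X : Type*} [NormedAddCommGroup X] [NormedSpace ℝ X] {H : Type*} [TopologicalSpace H]
  {I : ModelWithCorners ℝ X H} {M : Type*} [TopologicalSpace M] [ChartedSpace H M]

/-- The coefficients of a smooth combination of smooth functions are smooth near every parameter at
which the functions are linearly independent. -/
theorem exists_coefficients_smooth {α : Type*} {r : ℕ} {f : M → Fin r → α → E} {U : Set M}
    (hU : IsOpen U) (hf : ∀ x ∈ U, ∀ j a, ContMDiffAt I 𝓘(ℝ, E) ∞ (fun x => f x j a) x) {x₀ : M}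
    (hx₀ : x₀ ∈ U) (hli : LinearIndependent ℂ (f x₀)) :
    ∃ V ⊆ U, IsOpen V ∧ x₀ ∈ V ∧ ∀ x ∈ V, ∀ c : M → Fin r → ℂ,
      (∀ a, ContMDiffAt I 𝓘(ℝ, E) ∞ (fun x => ∑ j, c x j • f x j a) x) →
      ContMDiffAt I 𝓘(ℝ, Fin r → ℂ) ∞ c x := by
  obtain ⟨N, σ, l, hsep⟩ := exists_separating_evaluations hli
  let A : M → (Fin r → ℂ) →ₗ[ℂ] (Fin N → ℂ) := fun x =>
    LinearMap.pi fun k => (l k : E →ₗ[ℂ] ℂ) ∘ₗ Fintype.linearCombination ℂ fun j => f x j (σ k)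
  have hA : ∀ x c k, A x c k = l k (∑ j, c j • f x j (σ k)) := fun x c k => by
    simp [A, Fintype.linearCombination_apply]
  obtain ⟨G, hG⟩ := LinearMap.exists_leftInverse_of_injective (A x₀) (by
    rw [LinearMap.ker_eq_bot']
    intro c hc
    exact hsep c fun k => by rw [← hA, hc]; rfl)
  -- Composing the evaluation matrix with a left inverse at `x₀` gives a square matrix equal to the
  -- identity at `x₀`, hence invertible nearby.
  let B : M → (Fin r → ℂ) →L[ℂ] (Fin r → ℂ) := fun x =>
    LinearMap.toContinuousLinearMap (G ∘ₗ A x)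
  -- Fixed operators in terms of which `B x` is a combination with smooth scalar coefficients.
  let e : Fin N → Fin r → (Fin r → ℂ) →L[ℂ] (Fin r → ℂ) := fun k j =>
    (ContinuousLinearMap.proj j : (Fin r → ℂ) →L[ℂ] ℂ).smulRight (G (Pi.single k 1))
  have hB : ∀ x, B x = ∑ k, ∑ j, l k (f x j (σ k)) • e k j := by
    intro x
    ext1 c
    have h1 : A x c = ∑ k, (A x c k) • (Pi.single k 1 : Fin N → ℂ) := by
      ext i
      simp [Finset.sum_apply, Pi.single_apply]
    change G (A x c) = _
    rw [h1, map_sum]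
    simp only [map_smul, hA, map_sum, sum_apply, smul_apply, e,
      ContinuousLinearMap.smulRight_apply, ContinuousLinearMap.proj_apply, Finset.sum_smul]
    refine Finset.sum_congr rfl fun k _ => Finset.sum_congr rfl fun j _ => ?_
    rw [smul_eq_mul, smul_smul, mul_comm]
  have hBs : ∀ x ∈ U, ContMDiffAt I 𝓘(ℝ, (Fin r → ℂ) →L[ℂ] (Fin r → ℂ)) ∞ B x := by
    intro x hx
    have : B = fun x => ∑ k, ∑ j, l k (f x j (σ k)) • e k j := funext hB
    rw [this]
    refine ContMDiffAt.sum fun k _ => ContMDiffAt.sum fun j _ => ?_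
    exact contMDiffAt_complex_smul (contMDiffAt_const_clm_apply (l k) (hf x hx j (σ k)))
      contMDiffAt_const
  have hB₀ : (B x₀).IsInvertible := by
    refine ⟨ContinuousLinearEquiv.refl ℂ _, ?_⟩
    ext1 c
    exact (LinearMap.congr_fun hG c).symm
  have hBc : ContinuousOn B U := fun x hx => (hBs x hx).continuousAt.continuousWithinAt
  refine ⟨U ∩ B ⁻¹' {T | T.IsInvertible}, inter_subset_left, ?_, ⟨hx₀, hB₀⟩, ?_⟩
  · exact hBc.isOpen_inter_preimage hU ContinuousLinearEquiv.isOpen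
  · rintro x ⟨hxU, hxB⟩ c hc
    have h1 : ContMDiffAt I 𝓘(ℝ, Fin N → ℂ) ∞ (fun x => A x (c x)) x := by
      rw [contMDiffAt_pi_space]
      intro k
      simp only [hA]
      -- The smoothness of `c` is not known here; it is the combination that is smooth, and `c` is
      -- then solved for by inverting `B`.
      exact contMDiffAt_const_clm_apply (l k) (hc (σ k))
    have h2 : ContMDiffAt I 𝓘(ℝ, Fin r → ℂ) ∞ (fun x => B x (c x)) x :=
      contMDiffAt_const_clm_apply (LinearMap.toContinuousLinearMap G) h1
    refine (contMDiffAt_complex_clm_apply (contMDiffAt_clm_inverse (hBs x hxU) hxB)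
      h2).congr_of_eventuallyEq ?_
    have h3 : ∀ᶠ y in 𝓝 x, (B y).IsInvertible :=
      eventually_isInvertible hxB (hBs x hxU).continuousAt
    filter_upwards [h3] with y hy
    exact (hy.inverse_apply_self _).symm

end Coefficients

/-! ### Local frames of the kernel bundle in trivializations -/

section LocalFrame

variable {n : ℕ} {Y : Type*} [TopologicalSpace Y] [ChartedSpace (EuclideanSpace ℝ (Fin n)) Y]
  {E F : Type*} [NormedAddCommGroup E] [NormedSpace ℂ E] [CompleteSpace E]
  [NormedAddCommGroup F] [NormedSpace ℂ F]

theorem exists_isolating_radius {Z : Set ℂ} (hZ : Z.Finite) {W : Set ℂ} (hW : IsOpen W)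
    (hZW : Z ⊆ W) : ∃ δ > 0, (∀ q ∈ Z, Metric.closedBall q δ ⊆ W) ∧
      ∀ q ∈ Z, ∀ q' ∈ Z, q ≠ q' →
        Disjoint (Metric.closedBall q δ) (Metric.closedBall q' δ) := by
  have h1 : ∀ᶠ δ in 𝓝[>] (0 : ℝ), ∀ q ∈ Z, Metric.closedBall q δ ⊆ W := by
    rw [eventually_all_finite hZ]
    exact fun q hq => (eventually_closedBall_subset (hW.mem_nhds (hZW hq))).filter_mono
      nhdsWithin_le_nhds
  have h2 : ∀ᶠ δ in 𝓝[>] (0 : ℝ), ∀ q ∈ Z, ∀ q' ∈ Z, q ≠ q' →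
      Disjoint (Metric.closedBall q δ) (Metric.closedBall q' δ) := by
    rw [eventually_all_finite hZ]
    intro q _
    rw [eventually_all_finite hZ]
    intro q' _
    by_cases hqq : q = q'
    · exact Eventually.of_forall fun δ h => (h hqq).elim
    · have hpos : 0 < dist q q' / 2 := half_pos (dist_pos.2 hqq)
      filter_upwards [nhdsWithin_le_nhds (Iio_mem_nhds hpos)] with δ hδ _
      refine Metric.closedBall_disjoint_closedBall ?_
      have : δ < dist q q' / 2 := hδ
      linarith
  obtain ⟨δ, ⟨h1, h2⟩, h3⟩ := ((h1.and h2).and self_mem_nhdsWithin).exists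
  exact ⟨δ, h3, h1, h2⟩

/-- The singular part of the solution of `A y f = h` is smooth off the singular set. -/
theorem contMDiffAt_singularPart [IsManifold (𝓡 n) ∞ Y] {O : Set Y} (hO : IsOpen O) {S : Set ℂ}
    (hS : IsOpen S) {A : Y → ℂ → E →L[ℂ] F}
    (hA : ContMDiffOn ((𝓡 n).prod 𝓘(ℝ, ℂ)) 𝓘(ℝ, E →L[ℂ] F) ∞ (fun p : Y × ℂ => A p.1 p.2)
      (O ×ˢ S)) [CompleteSpace F]
    {K : Set ℂ} (hKS : K ⊆ S) {y₁ : Y} (hy₁ : y₁ ∈ O) (hfin : (singPts S (A y₁)).Finite)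
    (hK : singPts S (A y₁) ⊆ interior K)
    (husc : ∀ V : Set ℂ, IsOpen V → singPts S (A y₁) ⊆ V →
      ∀ᶠ y in 𝓝 y₁, singPts S (A y) ⊆ V)
    {h : ℂ → F} (hh : DifferentiableOn ℂ h (interior K)) {s : Y → ℂ → E}
    (hs : ∀ᶠ y in 𝓝 y₁, s y ∈ polarSums (singPts S (A y)) E ∧
      ∃ u : ℂ → E, DifferentiableOn ℂ u (interior K) ∧
        ∀ w ∈ interior K, w ∉ singPts S (A y) → h w = A y w (u w + s y w))
    {σ₁ : ℂ} (hσ₁ : σ₁ ∉ singPts S (A y₁)) :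
    ContMDiffAt ((𝓡 n).prod 𝓘(ℝ, ℂ)) 𝓘(ℝ, E) ∞ (fun p : Y × ℂ => s p.1 p.2) (y₁, σ₁) := by
  -- Removing `σ₁` from the open set makes the discs avoid it, so the Cauchy kernel `(σ - ζ)⁻¹` is
  -- smooth for `σ` near `σ₁` and `ζ` on the circles.
  obtain ⟨δ, hδ, hball, hdisj⟩ := exists_isolating_radius hfin
    (isOpen_interior.sdiff isClosed_singleton)
    (fun q hq => (⟨hK hq, fun h => hσ₁ (h ▸ hq)⟩ : q ∈ interior K \ {σ₁}))
  set Z := hfin.toFinset with hZ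
  have hmem : ∀ {q}, q ∈ Z ↔ q ∈ singPts S (A y₁) := hfin.mem_toFinset
  set V : Set ℂ := ⋃ q ∈ Z, Metric.ball q δ with hV
  have hVo : IsOpen V := isOpen_biUnion fun q _ => Metric.isOpen_ball
  have hsub : ∀ q ∈ Z, Metric.closedBall q δ ⊆ interior K := fun q hq z hz =>
    (hball q (hmem.1 hq) hz).1
  have hsph : ∀ q ∈ Z, ∀ ζ ∈ Metric.sphere q δ, ζ ∉ V := by
    intro q hq ζ hζ hζV
    obtain ⟨q', hq', hζ'⟩ := mem_iUnion₂.1 hζV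
    rcases eq_or_ne q q' with rfl | hne
    · exact (Metric.mem_ball.1 hζ').ne (Metric.mem_sphere.1 hζ)
    · exact (hdisj q (hmem.1 hq) q' (hmem.1 hq') hne).le_bot
        ⟨Metric.sphere_subset_closedBall hζ, Metric.ball_subset_closedBall hζ'⟩
  have hyV : ∀ᶠ y in 𝓝 y₁, singPts S (A y) ⊆ V := husc V hVo fun q hq =>
    mem_iUnion₂.2 ⟨q, hmem.2 hq, Metric.mem_ball_self hδ⟩
  have hσV : ∀ᶠ σ in 𝓝 σ₁, ∀ q ∈ Z, σ ∉ Metric.closedBall q δ := by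
    rw [eventually_all_finset]
    exact fun q hq => Metric.isClosed_closedBall.isOpen_compl.mem_nhds fun h =>
      (hball q (hmem.1 hq) h).2 rfl
  -- For nearby `y` all singular points stay in the open discs, so the same circles compute the
  -- singular part of `(A y)⁻¹ h`; on the circles themselves `A y` is invertible.
  have hformula : ∀ᶠ p : Y × ℂ in 𝓝 (y₁, σ₁), s p.1 p.2 = ∑ q ∈ Z,
      (2 * Real.pi * Complex.I : ℂ)⁻¹ •
        ∮ ζ in C(q, δ), (p.2 - ζ)⁻¹ • (A p.1 ζ).inverse (h ζ) := by
    rw [nhds_prod_eq]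
    filter_upwards [(hyV.and hs).prod_mk hσV] with p hp
    obtain ⟨⟨hpV, hps, u, hu, hhu⟩, hpσ⟩ := hp
    refine eq_sum_circleIntegral (u := u) hδ.le
      (fun q hq q' hq' => hdisj q (hmem.1 hq) q' (hmem.1 hq')) (polarSums_mono hpV hps)
      (fun q hq z hz => hu.differentiableAt (isOpen_interior.mem_nhds (hsub q hq hz)))
      (fun q hq z hz => ?_) hpσ
    have hzK := hsub q hq (Metric.sphere_subset_closedBall hz)
    have hzn : z ∉ singPts S (A p.1) := fun h => hsph q hq z hz (hpV h)
    rw [hhu z hzK hzn]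
    exact (isInvertible_of_notMem (hKS (interior_subset hzK)) hzn).inverse_apply_self _
  refine ContMDiffAt.congr_of_eventuallyEq (ContMDiffAt.sum fun q hq => ?_) hformula
  refine contMDiffAt_complex_smul contMDiffAt_const ?_
  let R : Set (Y × ℂ) := (O ×ˢ interior K) ∩ (fun p : Y × ℂ => A p.1 p.2) ⁻¹' {T | T.IsInvertible}
  have hKiS : interior K ⊆ S := interior_subset.trans hKS
  have hR : IsOpen R := (hA.continuousOn.mono (prod_mono_right hKiS)).isOpen_inter_preimage
    (hO.prod isOpen_interior) ContinuousLinearEquiv.isOpen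
  let π₁ : (Y × ℂ) × ℂ → Y × ℂ := fun x => (x.1.1, x.2)
  have hπ₁ : ContMDiff (((𝓡 n).prod 𝓘(ℝ, ℂ)).prod 𝓘(ℝ, ℂ)) ((𝓡 n).prod 𝓘(ℝ, ℂ)) ∞ π₁ :=
    (contMDiff_fst.comp contMDiff_fst).prodMk contMDiff_snd
  -- The parameter of the contour integral is the pair `(y, σ)` and the last variable is `ζ`; on
  -- this open set the integrand is smooth in all three.
  let G : Set ((Y × ℂ) × ℂ) := π₁ ⁻¹' R ∩ {x | x.1.2 - x.2 ≠ 0}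
  have hsubs : Continuous fun x : (Y × ℂ) × ℂ => x.1.2 - x.2 := by fun_prop
  have hG : IsOpen G := (hR.preimage hπ₁.continuous).inter (isOpen_ne.preimage hsubs)
  refine contMDiffAt_circleIntegral (I := (𝓡 n).prod 𝓘(ℝ, ℂ))
    (f := fun x : (Y × ℂ) × ℂ => (x.1.2 - x.2)⁻¹ • (A x.1.1 x.2).inverse (h x.2)) hG ?_ hδ.le ?_
  · rintro x ⟨⟨⟨hxO, hxK⟩, hxi⟩, hxs⟩
    refine ContMDiffAt.contMDiffWithinAt ?_
    have hdiff : ContMDiffAt (((𝓡 n).prod 𝓘(ℝ, ℂ)).prod 𝓘(ℝ, ℂ)) 𝓘(ℝ, ℂ) ∞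
        (fun x : (Y × ℂ) × ℂ => x.1.2 - x.2) x :=
      (contMDiffAt_snd.comp x contMDiffAt_fst).sub contMDiffAt_snd
    have hinv : ContDiffAt ℝ ∞ (fun w : ℂ => w⁻¹) (x.1.2 - x.2) := contDiffAt_inv ℝ hxs
    have hAx : ContMDiffAt (((𝓡 n).prod 𝓘(ℝ, ℂ)).prod 𝓘(ℝ, ℂ)) 𝓘(ℝ, E →L[ℂ] F) ∞
        (fun x : (Y × ℂ) × ℂ => A x.1.1 x.2) x :=
      (hA.contMDiffAt ((hO.prod hS).mem_nhds ⟨hxO, hKiS hxK⟩)).comp x hπ₁.contMDiffAt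
    have hhx : ContDiffAt ℝ ∞ h x.2 :=
      ((hh.analyticAt (isOpen_interior.mem_nhds hxK)).contDiffAt (n := ∞)).restrict_scalars ℝ
    exact contMDiffAt_complex_smul (ContDiffAt.comp_contMDiffAt (f := fun x : (Y × ℂ) × ℂ => x.1.2 - x.2) hinv hdiff)
      (contMDiffAt_complex_clm_apply (contMDiffAt_clm_inverse hAx hxi)
        (ContDiffAt.comp_contMDiffAt (f := fun x : (Y × ℂ) × ℂ => x.2) hhx contMDiffAt_snd))
  · intro ζ hζ
    have hζK := hsub q hq (Metric.sphere_subset_closedBall hζ)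
    have hζn : ζ ∉ singPts S (A y₁) := fun hζs => hsph q hq ζ hζ
      (mem_iUnion₂.2 ⟨ζ, hmem.2 hζs, Metric.mem_ball_self hδ⟩)
    refine ⟨⟨⟨hy₁, hζK⟩, isInvertible_of_notMem (hKiS hζK) hζn⟩, sub_ne_zero.2 fun h => ?_⟩
    exact hσV.self_of_nhds q hq (by
      change σ₁ = ζ at h
      rw [h]
      exact Metric.sphere_subset_closedBall hζ)

variable [CompleteSpace F]

/-- A smooth family of Fredholm families has, near each parameter, a frame for the spaces of
singular parts that is smooth off the singular set, and the coefficients of combinations that are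
smooth off the singular set are smooth. -/
theorem exists_local_frame [IsManifold (𝓡 n) ∞ Y] {O : Set Y} (hO : IsOpen O) {S : Set ℂ}
    (hS : IsOpen S) {A : Y → ℂ → E →L[ℂ] F}
    (hA : ContMDiffOn ((𝓡 n).prod 𝓘(ℝ, ℂ)) 𝓘(ℝ, E →L[ℂ] F) ∞ (fun p : Y × ℂ => A p.1 p.2)
      (O ×ˢ S)) (hF : ∀ y ∈ O, IsFredholmOn S (A y))
    (husc : ∀ y ∈ O, ∀ V : Set ℂ, IsOpen V → singPts S (A y) ⊆ V →
      ∀ᶠ y' in 𝓝 y, singPts S (A y') ⊆ V) {y₀ : Y} (hy₀ : y₀ ∈ O) :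
    ∃ U ⊆ O, IsOpen U ∧ y₀ ∈ U ∧ ∃ (r : ℕ) (s : ∀ y, Fin r → kernelSpace S (A y)),
      (∀ y ∈ U, Function.Bijective (Fintype.linearCombination ℂ (s y))) ∧
      (∀ y ∈ U, ∀ σ, σ ∉ singPts S (A y) → ∀ j,
        ContMDiffAt ((𝓡 n).prod 𝓘(ℝ, ℂ)) 𝓘(ℝ, E) ∞ (fun p : Y × ℂ => (s p.1 j).1 p.2) (y, σ)) ∧
      ∀ y ∈ U, ∀ c : Y → Fin r → ℂ,
        (∀ σ, σ ∉ singPts S (A y) →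
          ContMDiffAt (𝓡 n) 𝓘(ℝ, E) ∞ (fun y => ∑ j, c y j • (s y j).1 σ) y) →
        ContMDiffAt (𝓡 n) 𝓘(ℝ, Fin r → ℂ) ∞ c y := by
  classical
  obtain ⟨K, hKc, hK₀, hKS⟩ := exists_compact_between (hF y₀ hy₀).finite.isCompact hS
    fun p hp => hp.1
  obtain ⟨O₁, hO₁, hO₁o, hy₀₁⟩ := eventually_nhds_iff.1
    ((husc y₀ hy₀ _ isOpen_interior hK₀).and (hO.mem_nhds hy₀))
  have hO₁O : O₁ ⊆ O := fun y hy => (hO₁ y hy).2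
  have hcont : ContinuousOn (fun p : O₁ × ℂ => A p.1 p.2) (univ ×ˢ S) :=
    hA.continuousOn.comp (f := fun p : O₁ × ℂ => ((p.1 : Y), p.2)) (by fun_prop)
      fun p hp => ⟨hO₁O p.1.2, hp.2⟩
  obtain ⟨r, h, s₁, hs₁, hbij₁⟩ := exists_stable_basis (A := fun y : O₁ => A y) hS hKc hKS hcont
    (fun y => hF y (hO₁O y.2)) (fun y => (hO₁ y y.2).1) ⟨y₀, hy₀₁⟩
  let s : ∀ y, Fin r → kernelSpace S (A y) := fun y =>
    if hy : y ∈ O₁ then s₁ ⟨y, hy⟩ else 0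
  have hss : ∀ y (hy : y ∈ O₁), s y = s₁ ⟨y, hy⟩ := fun y hy => dif_pos hy
  have hbij : ∀ᶠ y in 𝓝 y₀, Function.Bijective (Fintype.linearCombination ℂ (s y)) := by
    have := hO₁o.isOpenEmbedding_subtypeVal.map_nhds_eq ⟨y₀, hy₀₁⟩
    rw [← this, eventually_map]
    filter_upwards [hbij₁] with y hy
    rw [hss y y.2]
    exact hy
  obtain ⟨O₂, hO₂, hO₂o, hy₀₂⟩ := eventually_nhds_iff.1 (hbij.and (hO₁o.mem_nhds hy₀₁))
  have hO₂₁ : O₂ ⊆ O₁ := fun y hy => (hO₂ y hy).2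
  have hsmooth : ∀ y ∈ O₂, ∀ σ, σ ∉ singPts S (A y) → ∀ j,
      ContMDiffAt ((𝓡 n).prod 𝓘(ℝ, ℂ)) 𝓘(ℝ, E) ∞ (fun p : Y × ℂ => (s p.1 j).1 p.2) (y, σ) := by
    intro y hy σ hσ j
    refine contMDiffAt_singularPart (K := K) (h := extendZero (h j).1) (s := fun y => (s y j).1)
      hO hS hA hKS (hO₁O (hO₂₁ hy)) (hF y (hO₁O (hO₂₁ hy))).finite (hO₁ y (hO₂₁ hy)).1
      (husc y (hO₁O (hO₂₁ hy))) (h j).2 ?_ hσ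
    filter_upwards [hO₁o.mem_nhds (hO₂₁ hy)] with y' hy'
    refine ⟨(hF y' (hO₁O hy')).mem_polarSums hS (s y' j).2, ?_⟩
    obtain ⟨u, hu⟩ := hs₁ ⟨y', hy'⟩ j
    refine ⟨extendZero u.1, u.2, fun w hw hwn => ?_⟩
    rw [hss y' hy']
    exact hu w (interior_subset hw) hwn
  -- Points outside `K` are nonsingular for all these parameters at once and can serve as fixed
  -- evaluation points.
  have hKn : ∀ y ∈ O₂, ∀ σ ∈ Kᶜ, σ ∉ singPts S (A y) := fun y hy σ hσ hσs =>
    hσ (interior_subset ((hO₁ y (hO₂₁ hy)).1 hσs))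
  -- Nothing is lost by restricting to the complement of `K`: it is open and nonempty, so a polar
  -- sum that vanishes there is zero.
  have hli : LinearIndependent ℂ (fun j (σ : (Kᶜ : Set ℂ)) => (s y₀ j).1 (σ : ℂ)) := by
    rw [Fintype.linearIndependent_iff]
    intro c hc
    have h1 : Fintype.linearCombination ℂ (s y₀) c = 0 := by
      refine Subtype.ext ?_
      refine eq_zero_of_mem_polarSums_of_eqOn_open
        ((hF y₀ hy₀).mem_polarSums hS (Fintype.linearCombination ℂ (s y₀) c).2)
        hKc.isClosed.isOpen_compl ?_ fun σ hσ => ?_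
      · exact nonempty_compl.2 fun hcon => (noncompact_univ ℂ) (hcon ▸ hKc)
      · have := congrFun hc ⟨σ, hσ⟩
        simpa [Fintype.linearCombination_apply, Finset.sum_apply] using this
    have h2 : c = 0 := (hO₂ y₀ hy₀₂).1.1 (h1.trans (map_zero _).symm)
    exact fun i => congrFun h2 i
  obtain ⟨U, hUO₂, hUo, hyU, hcoef⟩ := exists_coefficients_smooth (I := 𝓡 n)
    (f := fun y j (σ : (Kᶜ : Set ℂ)) => (s y j).1 (σ : ℂ)) hO₂o (fun y hy j σ =>
      (hsmooth y hy σ (hKn y hy σ σ.2) j).comp y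
        (contMDiffAt_id.prodMk contMDiffAt_const)) hy₀₂ hli
  exact ⟨U, fun y hy => hO₁O (hO₂₁ (hUO₂ hy)), hUo, hyU, r, s, fun y hy => (hO₂ y (hUO₂ hy)).1,
    fun y hy => hsmooth y (hUO₂ hy),
    fun y hy c hc => hcoef y hy c fun σ => hc σ (hKn y (hUO₂ hy) σ σ.2)⟩

end LocalFrame

/-! ### Transport by trivializations -/

section Transport

variable {E E' F F' : Type*} [NormedAddCommGroup E] [NormedSpace ℂ E]
  [NormedAddCommGroup E'] [NormedSpace ℂ E'] [NormedAddCommGroup F] [NormedSpace ℂ F]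
  [NormedAddCommGroup F'] [NormedSpace ℂ F'] {S : Set ℂ}

theorem completeSpace_of_equiv [CompleteSpace E'] (T : E ≃L[ℂ] E') : CompleteSpace E :=
  (completeSpace_congr (e := T.toEquiv) T.isUniformEmbedding).2 inferInstance

theorem isInvertible_conj_iff (T : E ≃L[ℂ] E') (R : F ≃L[ℂ] F') (A : E →L[ℂ] F) :
    ((R : F →L[ℂ] F') ∘L A ∘L (T.symm : E' →L[ℂ] E)).IsInvertible ↔ A.IsInvertible := by
  simp

theorem singPts_conj (T : E ≃L[ℂ] E') (R : F ≃L[ℂ] F') (A : ℂ → E →L[ℂ] F) :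
    singPts S (fun σ => (R : F →L[ℂ] F') ∘L A σ ∘L (T.symm : E' →L[ℂ] E)) = singPts S A := by
  ext σ
  simp only [singPts, mem_ofPred_eq, isInvertible_conj_iff]

theorem comp_mem_polarSums (L : E →L[ℂ] E') {V : Set ℂ} {s : ℂ → E} (hs : s ∈ polarSums V E) :
    (fun σ => L (s σ)) ∈ polarSums V E' := by
  induction hs using Submodule.span_induction with
  | mem s h =>
    obtain ⟨p, hp, k, a, rfl⟩ := h
    simp only [map_smul]
    exact single_mem_polarSums hp k (L a)
  | zero =>
    simp only [Pi.zero_apply, map_zero]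
    exact zero_mem _
  | add s t _ _ h₁ h₂ =>
    simp only [Pi.add_apply, map_add]
    exact add_mem h₁ h₂
  | smul c s _ h =>
    simp only [Pi.smul_apply, map_smul]
    exact Submodule.smul_mem _ c h

theorem differentiableOn_conj (T : E ≃L[ℂ] E') (R : F ≃L[ℂ] F') {A : ℂ → E →L[ℂ] F}
    (hA : DifferentiableOn ℂ A S) :
    DifferentiableOn ℂ (fun σ => (R : F →L[ℂ] F') ∘L A σ ∘L (T.symm : E' →L[ℂ] E)) S :=
  (differentiableOn_const _).clm_comp (hA.clm_comp (differentiableOn_const _))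

theorem comp_mem_kernelSpace [CompleteSpace F] [CompleteSpace F'] (hS : IsOpen S)
    (T : E ≃L[ℂ] E') (R : F ≃L[ℂ] F') {A : ℂ → E →L[ℂ] F} (hA : DifferentiableOn ℂ A S)
    {s : ℂ → E} (hs : s ∈ kernelSpace S A) : (fun σ => T (s σ)) ∈
      kernelSpace S (fun σ => (R : F →L[ℂ] F') ∘L A σ ∘L (T.symm : E' →L[ℂ] E)) := by
  rw [mem_kernelSpace_iff hS hA] at hs
  rw [mem_kernelSpace_iff hS (differentiableOn_conj T R hA)]
  refine ⟨comp_mem_polarSums (T : E →L[ℂ] E') hs.1, fun p hp => ?_⟩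
  refine (IsRegularAt.clm_apply (A := fun _ => (R : F →L[ℂ] F')) analyticAt_const
    (hs.2 p hp)).congr (Eventually.of_forall fun σ => ?_)
  simp

theorem mem_kernelSpace_of_comp [CompleteSpace F] [CompleteSpace F'] (hS : IsOpen S)
    (T : E ≃L[ℂ] E') (R : F ≃L[ℂ] F') {A : ℂ → E →L[ℂ] F} (hA : DifferentiableOn ℂ A S)
    {s : ℂ → E'}
    (hs : s ∈ kernelSpace S (fun σ => (R : F →L[ℂ] F') ∘L A σ ∘L (T.symm : E' →L[ℂ] E))) :
    (fun σ => T.symm (s σ)) ∈ kernelSpace S A := by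
  have h := comp_mem_kernelSpace hS T.symm R.symm (differentiableOn_conj T R hA) hs
  convert h using 2
  ext σ v
  simp

/-- Conjugation by isomorphisms induces an isomorphism of the spaces of singular parts. -/
def kernelSpaceConj [CompleteSpace F] [CompleteSpace F'] (hS : IsOpen S)
    (T : E ≃L[ℂ] E') (R : F ≃L[ℂ] F') {A : ℂ → E →L[ℂ] F} (hA : DifferentiableOn ℂ A S)
    {A' : ℂ → E' →L[ℂ] F'}
    (hA' : A' = fun σ => (R : F →L[ℂ] F') ∘L A σ ∘L (T.symm : E' →L[ℂ] E)) :
    kernelSpace S A' ≃ₗ[ℂ] kernelSpace S A where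
  toFun s := ⟨fun σ => T.symm (s.1 σ), mem_kernelSpace_of_comp hS T R hA (hA' ▸ s.2)⟩
  invFun s := ⟨fun σ => T (s.1 σ), hA' ▸ comp_mem_kernelSpace hS T R hA s.2⟩
  map_add' _ _ := Subtype.ext (funext fun _ => map_add T.symm _ _)
  map_smul' c _ := Subtype.ext (funext fun _ => map_smul T.symm c _)
  left_inv _ := Subtype.ext (funext fun _ => T.apply_symm_apply _)
  right_inv _ := Subtype.ext (funext fun _ => T.symm_apply_apply _)

theorem IsFredholmOn.conj (T : E ≃L[ℂ] E') (R : F ≃L[ℂ] F') {A : ℂ → E →L[ℂ] F}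
    (hA : IsFredholmOn S A) :
    IsFredholmOn S (fun σ => (R : F →L[ℂ] F') ∘L A σ ∘L (T.symm : E' →L[ℂ] E)) where
  differentiableOn := differentiableOn_conj T R hA.differentiableOn
  correction p hp := by
    obtain ⟨N, C, B, h⟩ := hA.correction p hp
    refine ⟨N, C ∘L (T.symm : E' →L[ℂ] E), (R : F →L[ℂ] F') ∘L B, ?_⟩
    rw [← isInvertible_conj_iff T R] at h
    convert h using 1
    ext v
    simp
  finite := by rw [singPts_conj]; exact hA.finite

end Transport

/-! ### Local frames of the kernel bundle -/

section Frame

variable {Y : Type*} [TopologicalSpace Y] {D H₂ : Y → Type*}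
  [∀ y, NormedAddCommGroup (D y)] [∀ y, NormedSpace ℂ (D y)]
  [∀ y, NormedAddCommGroup (H₂ y)] [∀ y, NormedSpace ℂ (H₂ y)]
  {S : Set ℂ} {P : ∀ y, ℂ → D y →L[ℂ] H₂ y}

/-- The singular points depend upper semicontinuously on the parameter. -/
theorem eventually_singPts_subset (hclosed : IsClosed (singGraph S P)) {y₀ : Y}
    (hbdd : ∃ U ∈ 𝓝 y₀, Bornology.IsBounded (⋃ y ∈ U, singPts S (P y))) {V : Set ℂ}
    (hV : IsOpen V) (h : singPts S (P y₀) ⊆ V) : ∀ᶠ y in 𝓝 y₀, singPts S (P y) ⊆ V := by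
  obtain ⟨U, hU, hb⟩ := hbdd
  obtain ⟨R, hR⟩ := hb.subset_closedBall 0
  obtain ⟨u, v, hu, -, hyu, hCv, huv⟩ := generalized_tube_lemma (isCompact_singleton (x := y₀))
    ((isCompact_closedBall (0 : ℂ) R).diff hV) hclosed.isOpen_compl (by
      rintro ⟨y, σ⟩ ⟨hy, hσ⟩ hs
      obtain rfl : y = y₀ := hy
      exact hσ.2 (h hs))
  filter_upwards [hU, hu.mem_nhds (hyu rfl)] with y hyU hyu σ hσ
  by_contra hσV
  exact (huv (show (y, σ) ∈ u ×ˢ v from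
    ⟨hyu, hCv ⟨hR (mem_iUnion₂.2 ⟨y, hyU, hσ⟩), hσV⟩⟩)) hσ

variable {n : ℕ} [ChartedSpace (EuclideanSpace ℝ (Fin n)) Y]
  {FD F₂ : Type*} [NormedAddCommGroup FD] [NormedSpace ℂ FD]
  [NormedAddCommGroup F₂] [NormedSpace ℂ F₂]
  [TopologicalSpace (TotalSpace FD D)] [FiberBundle FD D] [VectorBundle ℂ FD D]
  [TopologicalSpace (TotalSpace F₂ H₂)] [FiberBundle F₂ H₂] [VectorBundle ℂ F₂ H₂]

variable (n FD) in
/-- A local frame of the kernel bundle over an open set: a family of bases that is smooth off the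
singular set, such that the coefficients of combinations that are smooth off the singular set are
smooth. -/
structure IsKernelFrame (S : Set ℂ) (P : ∀ y, ℂ → D y →L[ℂ] H₂ y) (U : Set Y) {r : ℕ}
    (s : ∀ y, Fin r → KernelFiber S P y) : Prop where
  isOpen : IsOpen U
  bijective : ∀ y ∈ U, Function.Bijective (Fintype.linearCombination ℂ (s y))
  smooth : ∀ y ∈ U, ∀ σ, σ ∉ singPts S (P y) → ∀ j,
    ContMDiffAt ((𝓡 n).prod 𝓘(ℝ, ℂ)) ((𝓡 n).prod 𝓘(ℝ, FD)) ∞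
      (fun p : Y × ℂ => TotalSpace.mk' FD p.1 ((s p.1 j).toFun p.2)) (y, σ)
  coeff_smooth : ∀ y ∈ U, ∀ c : Y → Fin r → ℂ,
    (∀ σ, σ ∉ singPts S (P y) → ContMDiffAt (𝓡 n) ((𝓡 n).prod 𝓘(ℝ, FD)) ∞
      (fun y => TotalSpace.mk' FD y (∑ j, c y j • (s y j).toFun σ)) y) →
    ContMDiffAt (𝓡 n) 𝓘(ℝ, Fin r → ℂ) ∞ c y

variable [CompleteSpace FD] [CompleteSpace F₂]

theorem IsHolomorphicFredholmFamily.isFredholmOn {H₁ : Y → Type*}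
    [∀ y, NormedAddCommGroup (H₁ y)] [∀ y, NormedSpace ℂ (H₁ y)] {i : ∀ y, D y →L[ℂ] H₁ y}
    (hP : IsHolomorphicFredholmFamily n FD F₂ i S P) (hfin : ∀ y, (singPts S (P y)).Finite)
    (y : Y) : IsFredholmOn S (P y) := by
  -- Completeness of the fibers is inherited from the model spaces by way of the trivializations.
  have : CompleteSpace (D y) := completeSpace_of_equiv
    ((trivializationAt FD D y).continuousLinearEquivAt ℂ y (mem_baseSet_trivializationAt FD D y))
  have : CompleteSpace (H₂ y) := completeSpace_of_equiv
    ((trivializationAt F₂ H₂ y).continuousLinearEquivAt ℂ y (mem_baseSet_trivializationAt F₂ H₂ y))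
  exact ⟨hP.holomorphic y, fun σ hσ =>
    hasFiniteRankCorrection_of_isFredholm (hP.fredholm y σ hσ) (hP.index_eq_zero y σ hσ), hfin y⟩

/-- Near `y₀` the family is conjugated by trivializations to one between the fixed model spaces.
Conjugation does not change the singular points and carries kernel spaces isomorphically to kernel
spaces, so the local frame found for the model family can be carried back. -/
theorem exists_isKernelFrame [IsManifold (𝓡 n) ∞ Y] [ContMDiffVectorBundle ∞ FD D (𝓡 n)]
    (hS : IsOpen S)
    (hsmooth : ∀ (e : Trivialization FD (π FD D)) [MemTrivializationAtlas e]
      (e₂ : Trivialization F₂ (π F₂ H₂)) [MemTrivializationAtlas e₂],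
      ContMDiffOn ((𝓡 n).prod 𝓘(ℝ, ℂ)) 𝓘(ℝ, FD →L[ℂ] F₂) ∞
        (fun p : Y × ℂ =>
          (e₂.continuousLinearMapAt ℂ p.1) ∘L (P p.1 p.2) ∘L (e.symmL ℂ p.1))
        ((e.baseSet ∩ e₂.baseSet) ×ˢ S))
    (hP : ∀ y, IsFredholmOn S (P y)) (hclosed : IsClosed (singGraph S P))
    (hbdd : ∀ y₀ : Y, ∃ U ∈ 𝓝 y₀, Bornology.IsBounded (⋃ y ∈ U, singPts S (P y))) (y₀ : Y) :
    ∃ (U : Set Y) (r : ℕ) (s : ∀ y, Fin r → KernelFiber S P y), y₀ ∈ U ∧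
      IsKernelFrame n FD S P U s := by
  classical
  set e := trivializationAt FD D y₀ with he
  set e₂ := trivializationAt F₂ H₂ y₀ with he₂
  set O : Set Y := e.baseSet ∩ e₂.baseSet with hOdef
  have hO : IsOpen O := e.open_baseSet.inter e₂.open_baseSet
  let A : Y → ℂ → FD →L[ℂ] F₂ := fun y σ =>
    (e₂.continuousLinearMapAt ℂ y) ∘L (P y σ) ∘L (e.symmL ℂ y)
  let T : ∀ y ∈ O, D y ≃L[ℂ] FD := fun y hy => e.continuousLinearEquivAt ℂ y hy.1
  let R : ∀ y ∈ O, H₂ y ≃L[ℂ] F₂ := fun y hy => e₂.continuousLinearEquivAt ℂ y hy.2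
  have hAT : ∀ y (hy : y ∈ O), A y = fun σ => ((R y hy : H₂ y →L[ℂ] F₂)) ∘L P y σ ∘L
      ((T y hy).symm : FD →L[ℂ] D y) := by
    intro y hy
    ext1 σ
    rw [e₂.coe_continuousLinearEquivAt_eq' hy.2, e.symm_continuousLinearEquivAt_eq' hy.1]
  have hF : ∀ y ∈ O, IsFredholmOn S (A y) := fun y hy => by
    rw [hAT y hy]
    exact (hP y).conj _ _
  have hsing : ∀ y ∈ O, singPts S (A y) = singPts S (P y) := fun y hy => by
    rw [hAT y hy, singPts_conj]
  have husc : ∀ y ∈ O, ∀ V : Set ℂ, IsOpen V → singPts S (A y) ⊆ V →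
      ∀ᶠ y' in 𝓝 y, singPts S (A y') ⊆ V := by
    intro y hy V hV h
    rw [hsing y hy] at h
    filter_upwards [eventually_singPts_subset hclosed (hbdd y) hV h, hO.mem_nhds hy] with y' h' hy'
    rwa [hsing y' hy']
  have hy₀ : y₀ ∈ O := ⟨mem_baseSet_trivializationAt FD D y₀, mem_baseSet_trivializationAt F₂ H₂ y₀⟩
  obtain ⟨U, hUO, hU, hyU, r, sA, hbij, hsm, hcoef⟩ :=
    exists_local_frame (n := n) hO hS (hsmooth e e₂) hF husc hy₀
  have hcompl : ∀ y ∈ O, CompleteSpace (H₂ y) := fun y hy => completeSpace_of_equiv (R y hy)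
  let κ : ∀ y ∈ O, kernelSpace S (A y) ≃ₗ[ℂ] kernelSpace S (P y) := fun y hy =>
    have := hcompl y hy
    kernelSpaceConj hS (T y hy) (R y hy) (hP y).differentiableOn (hAT y hy)
  let s : ∀ y, Fin r → KernelFiber S P y := fun y j =>
    if hy : y ∈ O then (κ y hy (sA y j) : kernelSpace S (P y)) else 0
  have hs : ∀ y (hy : y ∈ O) j, s y j = κ y hy (sA y j) := fun y hy j => dif_pos hy
  have hval : ∀ y ∈ O, ∀ j σ, (s y j).toFun σ = e.symm y ((sA y j).1 σ) := by
    intro y hy j σ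
    rw [hs y hy j]
    rfl
  have heval : ∀ y ∈ O, ∀ v, (e ⟨y, e.symm y v⟩).2 = v := fun y hy v => by
    rw [e.apply_mk_symm hy.1]
  refine ⟨U, r, s, hyU, hU, fun y hy => ?_, fun y hy σ hσ j => ?_, fun y hy c hc => ?_⟩
  · have hb := (κ y (hUO hy)).bijective.comp (hbij y hy)
    have h : ⇑(Fintype.linearCombination ℂ (s y)) =
        κ y (hUO hy) ∘ ⇑(Fintype.linearCombination ℂ (sA y)) := ?_
    · rw [h]
      exact hb
    funext c
    rw [Function.comp_apply, Fintype.linearCombination_apply, Fintype.linearCombination_apply,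
      map_sum]
    simp only [map_smul]
    refine Finset.sum_congr rfl fun j _ => ?_
    rw [hs y (hUO hy)]
    rfl
  · have h1 := hsm y hy σ (by rwa [hsing y (hUO hy)]) j
    refine (Trivialization.contMDiffAt_iff (e := e) (e.mem_source.2 (hUO hy).1)).2
      ⟨contMDiffAt_fst, h1.congr_of_eventuallyEq ?_⟩
    filter_upwards [(continuous_fst (X := Y) (Y := ℂ)).continuousAt.eventually (hO.mem_nhds (hUO hy))]
      with p hp
    rw [hval p.1 hp, heval p.1 hp]
  · refine hcoef y hy c fun σ hσ => ?_
    have h1 := ((Trivialization.contMDiffAt_iff (e := e) (e.mem_source.2 (hUO hy).1)).1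
      (hc σ (by rwa [← hsing y (hUO hy)]))).2
    refine h1.congr_of_eventuallyEq ?_
    filter_upwards [hO.mem_nhds (hUO hy)] with y' hy'
    have h2 : ∑ j, c y' j • (s y' j).toFun σ =
        (T y' hy').symm (∑ j, c y' j • (sA y' j).1 σ) := by
      rw [map_sum]
      refine Finset.sum_congr rfl fun j _ => ?_
      rw [map_smul, hval y' hy']
      rfl
    rw [h2]
    exact (heval y' hy' _).symm

end Frame

/-! ### Smooth complex vector bundles from families of bases -/

section Construction

variable {Y : Type*} [TopologicalSpace Y]
  {F : Type*} [NormedAddCommGroup F] [NormedSpace ℂ F]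
  {E : Y → Type*} [∀ y, AddCommGroup (E y)] [∀ y, Module ℂ (E y)]

/-- The pretrivialization whose fiberwise inverses are given linear bijections. -/
def frameTrivialization {U : Set Y} (hU : IsOpen U) (φ : ∀ y, F →ₗ[ℂ] E y)
    (hφ : ∀ y ∈ U, Function.Bijective (φ y)) : Pretrivialization F (π F E) where
  toFun p := (p.proj, Function.invFun (φ p.proj) p.2)
  invFun q := ⟨q.1, φ q.1 q.2⟩
  source := π F E ⁻¹' U
  target := U ×ˢ univ
  map_source' _ hp := ⟨hp, mem_univ _⟩
  map_target' _ hq := hq.1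
  left_inv' := by
    rintro ⟨y, x⟩ hy
    exact congrArg (TotalSpace.mk' F y) (Function.rightInverse_invFun (hφ y hy).2 x)
  right_inv' := by
    rintro ⟨y, v⟩ ⟨hy, -⟩
    exact congrArg (Prod.mk y) (Function.leftInverse_invFun (hφ y hy).1 v)
  open_target := hU.prod isOpen_univ
  baseSet := U
  open_baseSet := hU
  source_eq := rfl
  target_eq := rfl
  proj_toFun _ _ := rfl

section

variable {U : Set Y} (hU : IsOpen U) (φ : ∀ y, F →ₗ[ℂ] E y)
  (hφ : ∀ y ∈ U, Function.Bijective (φ y))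

theorem frameTrivialization_apply {y : Y} (hy : y ∈ U) {x : E y} {v : F} (h : φ y v = x) :
    (frameTrivialization hU φ hφ ⟨y, x⟩).2 = v := by
  rw [← h]
  exact Function.leftInverse_invFun (hφ y hy).1 v

theorem frameTrivialization_symm {y : Y} (hy : y ∈ U) (v : F) :
    (frameTrivialization hU φ hφ).symm y v = φ y v := by
  have h := (frameTrivialization hU φ hφ).mk_symm hy v
  have h' : (TotalSpace.mk' F y ((frameTrivialization hU φ hφ).symm y v)) =
      TotalSpace.mk' F y (φ y v) := h
  exact TotalSpace.mk_inj.1 h'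

theorem isLinear_frameTrivialization : (frameTrivialization hU φ hφ).IsLinear ℂ := by
  refine ⟨fun y hy => ⟨fun x x' => ?_, fun c x => ?_⟩⟩
  · obtain ⟨v, rfl⟩ := (hφ y hy).2 x
    obtain ⟨v', rfl⟩ := (hφ y hy).2 x'
    rw [frameTrivialization_apply hU φ hφ hy (map_add (φ y) v v'),
      frameTrivialization_apply hU φ hφ hy rfl, frameTrivialization_apply hU φ hφ hy rfl]
  · obtain ⟨v, rfl⟩ := (hφ y hy).2 x
    rw [frameTrivialization_apply hU φ hφ hy (map_smul (φ y) c v),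
      frameTrivialization_apply hU φ hφ hy rfl]

end

variable {n : ℕ} [ChartedSpace (EuclideanSpace ℝ (Fin n)) Y]

/-- Local families of linear bijections with smooth transition functions define a smooth complex
vector bundle, the smooth sections of which are those with smooth coordinates. -/
theorem exists_contMDiffVectorBundle {U : Y → Set Y} (hU : ∀ i, IsOpen (U i))
    (hmem : ∀ y, y ∈ U y) {φ : Y → ∀ y, F →ₗ[ℂ] E y}
    (hφ : ∀ i, ∀ y ∈ U i, Function.Bijective (φ i y)) {C : Y → Y → Y → F →L[ℂ] F}
    (hC : ∀ i k, ContMDiffOn (𝓡 n) 𝓘(ℝ, F →L[ℂ] F) ∞ (C i k) (U i ∩ U k))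
    (hCφ : ∀ i k, ∀ y ∈ U i ∩ U k, ∀ v, φ k y (C i k y v) = φ i y v) :
    ∃ (_ : TopologicalSpace (TotalSpace F E)) (_ : ∀ y, TopologicalSpace (E y))
      (_ : FiberBundle F E) (_ : VectorBundle ℂ F E),
      ContMDiffVectorBundle ∞ F E (𝓡 n) ∧
      ∀ (s : ∀ y, E y) (y₀ : Y) (c : Y → F), (∀ y ∈ U y₀, φ y₀ y (c y) = s y) →
        (ContMDiffAt (𝓡 n) ((𝓡 n).prod 𝓘(ℝ, F)) ∞ (fun y => TotalSpace.mk' F y (s y)) y₀ ↔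
          ContMDiffAt (𝓡 n) 𝓘(ℝ, F) ∞ c y₀) := by
  let _ : ∀ y, TopologicalSpace (E y) := fun y =>
    -- The fiber topology is that of the frame indexed by `y` itself, which is the pretrivialization
    -- chosen at `y`; the required inducing property of the fiber inclusion then holds by
    -- construction.
    TopologicalSpace.induced (Function.invFun (φ y y)) inferInstance
  let e : Y → Pretrivialization F (π F E) := fun i => frameTrivialization (hU i) (φ i) (hφ i)
  have hcoord : ∀ i k, ∀ y ∈ U i ∩ U k, ∀ v, C i k y v = (e k ⟨y, (e i).symm y v⟩).2 := by
    intro i k y hy v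
    rw [frameTrivialization_symm _ _ _ hy.1]
    exact (frameTrivialization_apply _ _ _ hy.2 (hCφ i k y hy v)).symm
  let a : VectorPrebundle ℂ F E :=
    { pretrivializationAtlas := range e
      pretrivialization_linear' := by
        rintro _ ⟨i, rfl⟩
        exact isLinear_frameTrivialization _ _ _
      pretrivializationAt := e
      mem_base_pretrivializationAt := hmem
      pretrivialization_mem_atlas := fun i => ⟨i, rfl⟩
      exists_coordChange := by
        rintro _ ⟨i, rfl⟩ _ ⟨k, rfl⟩
        exact ⟨C i k, (hC i k).continuousOn, hcoord i k⟩
      totalSpaceMk_isInducing := fun y => by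
        have h : IsInducing (Function.invFun (φ y y)) := ⟨rfl⟩
        exact (isEmbedding_prodMkRight y).isInducing.comp h }
  let _ : TopologicalSpace (TotalSpace F E) := a.totalSpaceTopology
  let _ : FiberBundle F E := a.toFiberBundle
  have : VectorBundle ℂ F E := a.toVectorBundle
  have hB : ContMDiffVectorBundle ∞ F E (𝓡 n) := by
    refine ⟨?_⟩
    intro t t' ht ht'
    obtain ⟨_, ⟨i, rfl⟩, rfl⟩ := id ht.out
    obtain ⟨_, ⟨k, rfl⟩, rfl⟩ := id ht'.out
    have hr : ContDiff ℝ ∞ (fun T : F →L[ℂ] F => T.restrictScalars ℝ) :=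
      (ContinuousLinearMap.restrictScalarsL ℂ F F ℝ ℝ).contDiff
    refine (hr.contMDiff.comp_contMDiffOn (hC i k)).congr fun y hy => ?_
    ext v
    refine (Trivialization.coordChangeL_apply _ _ hy v).trans ?_
    exact (hcoord i k y hy v).symm
  refine ⟨inferInstance, inferInstance, inferInstance, inferInstance, hB, fun s y₀ c hc => ?_⟩
  rw [contMDiffAt_section]
  refine Filter.EventuallyEq.contMDiffAt_iff ?_
  filter_upwards [(hU y₀).mem_nhds (hmem y₀)] with y hy
  exact frameTrivialization_apply (hU y₀) (φ y₀) (hφ y₀) hy (hc y hy)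

end Construction

/-! ### Smooth sections of the kernel bundle -/

section Sections

variable {Y : Type*} {D H₂ : Y → Type*}
  [∀ y, NormedAddCommGroup (D y)] [∀ y, NormedSpace ℂ (D y)]
  [∀ y, NormedAddCommGroup (H₂ y)] [∀ y, NormedSpace ℂ (H₂ y)]
  {S : Set ℂ} {P : ∀ y, ℂ → D y →L[ℂ] H₂ y}

theorem KernelFiber.toFun_linearCombination {r : ℕ} {y : Y} (s : Fin r → KernelFiber S P y)
    (c : Fin r → ℂ) (σ : ℂ) :
    (Fintype.linearCombination ℂ s c).toFun σ = ∑ j, c j • (s j).toFun σ := by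
  let ev : KernelFiber S P y →ₗ[ℂ] D y := LinearMap.proj σ ∘ₗ (kernelSpace S (P y)).subtype
  rw [Fintype.linearCombination_apply]
  refine (map_sum ev _ _).trans (Finset.sum_congr rfl fun j _ => ?_)
  exact map_smul ev _ _

variable [TopologicalSpace Y] {n : ℕ} [ChartedSpace (EuclideanSpace ℝ (Fin n)) Y]
  {FD : Type*} [NormedAddCommGroup FD] [NormedSpace ℂ FD]
  [TopologicalSpace (TotalSpace FD D)] [FiberBundle FD D]

variable {U : Set Y} {r : ℕ} {s : ∀ y, Fin r → KernelFiber S P y}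

/-- The coefficients of a section with respect to a frame. -/
def frameCoeff (s : ∀ y, Fin r → KernelFiber S P y) (t : ∀ y, KernelFiber S P y) (y : Y) :
    Fin r → ℂ :=
  Function.invFun (Fintype.linearCombination ℂ (s y)) (t y)

theorem IsKernelFrame.linearCombination_frameCoeff (hs : IsKernelFrame n FD S P U s)
    (t : ∀ y, KernelFiber S P y) (y : Y) (hy : y ∈ U) :
    Fintype.linearCombination ℂ (s y) (frameCoeff s t y) = t y :=
  Function.rightInverse_invFun (hs.bijective y hy).2 (t y)

/-- A frame computes the dimension of the fibers, which is therefore locally constant, hence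
constant on the connected base. -/
theorem exists_isKernelFrame_of_const_rank [PreconnectedSpace Y] [Nonempty Y]
    (h : ∀ y₀, ∃ (U : Set Y) (r : ℕ) (s : ∀ y, Fin r → KernelFiber S P y), y₀ ∈ U ∧
      IsKernelFrame n FD S P U s) :
    ∃ r : ℕ, ∀ y₀, ∃ (U : Set Y) (s : ∀ y, Fin r → KernelFiber S P y), y₀ ∈ U ∧
      IsKernelFrame n FD S P U s := by
  have hrank : ∀ {U : Set Y} {r : ℕ} {s : ∀ y, Fin r → KernelFiber S P y},
      IsKernelFrame n FD S P U s → ∀ y ∈ U, Module.finrank ℂ (KernelFiber S P y) = r := by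
    intro U r s hs y hy
    rw [← (LinearEquiv.ofBijective _ (hs.bijective y hy)).finrank_eq, Module.finrank_fin_fun]
  have hloc : IsLocallyConstant fun y => Module.finrank ℂ (KernelFiber S P y) := by
    refine (IsLocallyConstant.iff_eventually_eq _).2 fun y₀ => ?_
    obtain ⟨U, r, s, hy₀, hs⟩ := h y₀
    filter_upwards [hs.isOpen.mem_nhds hy₀] with y hy
    rw [hrank hs y hy, hrank hs y₀ hy₀]
  obtain ⟨y₁⟩ := ‹Nonempty Y›
  refine ⟨Module.finrank ℂ (KernelFiber S P y₁), fun y₀ => ?_⟩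
  obtain ⟨U, r, s, hy₀, hs⟩ := h y₀
  obtain rfl : r = Module.finrank ℂ (KernelFiber S P y₁) := by
    rw [← hrank hs y₀ hy₀]
    exact hloc.apply_eq_of_preconnectedSpace _ _
  exact ⟨U, s, hy₀, hs⟩

variable [VectorBundle ℂ FD D] [ContMDiffVectorBundle ∞ FD D (𝓡 n)]

/-- Holomorphy in `σ` is automatic, as every fiber element is a polar sum with poles at singular
points only. The remaining condition is smoothness on an open set, which can be tested pointwise in
one trivialization around each point. -/
theorem isSmoothOffSing_iff (hS : IsOpen S) (hP : ∀ y, IsFredholmOn S (P y))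
    [∀ y, CompleteSpace (D y)] [∀ y, CompleteSpace (H₂ y)]
    (hclosed : IsClosed (singGraph S P)) (s : ∀ y, KernelFiber S P y) :
    IsSmoothOffSing n FD S P s ↔ ∀ y, ∀ σ, σ ∉ singPts S (P y) →
      ContMDiffAt ((𝓡 n).prod 𝓘(ℝ, ℂ)) ((𝓡 n).prod 𝓘(ℝ, FD)) ∞
        (fun p : Y × ℂ => TotalSpace.mk' FD p.1 ((s p.1).toFun p.2)) (y, σ) := by
  have hdiff : ∀ y, DifferentiableOn ℂ (s y).toFun (singPts S (P y))ᶜ := fun y σ hσ =>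
    (analyticAt_of_mem_polarSums ((hP y).mem_polarSums hS (s y).2)
      hσ).differentiableAt.differentiableWithinAt
  have hnhds : ∀ (e : Trivialization FD (π FD D)), IsOpen ((e.baseSet ×ˢ univ) \ singGraph S P) :=
    fun e => (e.open_baseSet.prod isOpen_univ).sdiff hclosed
  refine ⟨fun h y σ hσ => ?_, fun h => ⟨fun e _ p hp => ?_, hdiff⟩⟩
  · have hy := mem_baseSet_trivializationAt FD D y
    refine (Trivialization.contMDiffAt_iff (e := trivializationAt FD D y)
      ((trivializationAt FD D y).mem_source.2 hy)).2 ⟨contMDiffAt_fst, ?_⟩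
    exact (h.1 _).contMDiffAt ((hnhds _).mem_nhds ⟨⟨hy, mem_univ _⟩, hσ⟩)
  · exact ((Trivialization.contMDiffAt_iff (e := e) (e.mem_source.2 hp.1.1)).1
      (h p.1 p.2 hp.2)).2.contMDiffWithinAt

theorem IsKernelFrame.contMDiffAt_sum (hs : IsKernelFrame n FD S P U s) {y : Y} (hy : y ∈ U)
    {σ : ℂ} (hσ : σ ∉ singPts S (P y)) {c : Y → Fin r → ℂ}
    (hc : ContMDiffAt (𝓡 n) 𝓘(ℝ, Fin r → ℂ) ∞ c y) :
    ContMDiffAt ((𝓡 n).prod 𝓘(ℝ, ℂ)) ((𝓡 n).prod 𝓘(ℝ, FD)) ∞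
      (fun p : Y × ℂ => TotalSpace.mk' FD p.1 (∑ j, c p.1 j • (s p.1 j).toFun p.2)) (y, σ) := by
  have hy' := mem_baseSet_trivializationAt FD D y
  set e := trivializationAt FD D y
  have hmem : ∀ v, (⟨y, v⟩ : TotalSpace FD D) ∈ e.source := fun v => e.mem_source.2 hy'
  refine (Trivialization.contMDiffAt_iff (e := e) (x₀ := (y, σ)) (by exact hmem _)).2 ⟨contMDiffAt_fst, ?_⟩
  have hterm : ∀ j, ContMDiffAt ((𝓡 n).prod 𝓘(ℝ, ℂ)) 𝓘(ℝ, FD) ∞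
      (fun p : Y × ℂ => c p.1 j • (e ⟨p.1, (s p.1 j).toFun p.2⟩).2) (y, σ) := fun j => by
    refine contMDiffAt_complex_smul ?_
      ((Trivialization.contMDiffAt_iff (e := e) (x₀ := (y, σ)) (by exact hmem _)).1 (hs.smooth y hy σ hσ j)).2
    exact ContMDiffAt.comp (x := (y, σ)) (f := Prod.fst) (g := fun y => c y j)
      (contMDiffAt_pi_space.1 hc j) contMDiffAt_fst
  refine (contMDiffAt_finsetSum (t := Finset.univ) fun j _ => hterm j).congr_of_eventuallyEq ?_
  filter_upwards [continuous_fst.continuousAt.eventually (e.open_baseSet.mem_nhds hy')] with p hp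
  have hlin : ∀ v, (e ⟨p.1, v⟩).2 = e.linearEquivAt ℂ p.1 hp v := fun v => rfl
  simp only [hlin, map_sum, map_smul]

/-- The coefficients with respect to a frame are smooth precisely for those sections of the kernel
bundle that are smooth off the singular set. -/
theorem IsKernelFrame.contMDiffAt_coeff_iff (hs : IsKernelFrame n FD S P U s) {y : Y} (hy : y ∈ U)
    {t : ∀ y, KernelFiber S P y} {c : Y → Fin r → ℂ}
    (hc : ∀ y ∈ U, Fintype.linearCombination ℂ (s y) (c y) = t y) :
    ContMDiffAt (𝓡 n) 𝓘(ℝ, Fin r → ℂ) ∞ c y ↔ ∀ σ, σ ∉ singPts S (P y) →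
      ContMDiffAt ((𝓡 n).prod 𝓘(ℝ, ℂ)) ((𝓡 n).prod 𝓘(ℝ, FD)) ∞
        (fun p : Y × ℂ => TotalSpace.mk' FD p.1 ((t p.1).toFun p.2)) (y, σ) := by
  have hU := hs.isOpen.mem_nhds hy
  have hsum : ∀ y ∈ U, ∀ σ, TotalSpace.mk' FD y ((t y).toFun σ) =
      TotalSpace.mk' FD y (∑ j, c y j • (s y j).toFun σ) := fun y hy σ => by
    rw [← hc y hy, KernelFiber.toFun_linearCombination]
  refine ⟨fun h σ hσ => (hs.contMDiffAt_sum hy hσ h).congr_of_eventuallyEq ?_,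
    fun h => hs.coeff_smooth y hy c fun σ hσ => ?_⟩
  · filter_upwards [continuous_fst.continuousAt.eventually hU] with p hp using hsum p.1 hp p.2
  · have h1 : ContMDiffAt (𝓡 n) ((𝓡 n).prod 𝓘(ℝ, FD)) ∞
        (fun y => TotalSpace.mk' FD y ((t y).toFun σ)) y :=
      ContMDiffAt.comp (f := fun y => (y, σ)) (x := y) (h σ hσ)
        (contMDiffAt_id.prodMk contMDiffAt_const)
    refine h1.congr_of_eventuallyEq ?_
    filter_upwards [hU] with y hy using (hsum y hy σ).symm

/-- Local frames make the kernel spaces into a smooth vector bundle, the smooth sections of which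
are the sections that are smooth off the singular set. -/
theorem exists_kernelBundle
    (h : ∀ y₀, ∃ (U : Set Y) (s : ∀ y, Fin r → KernelFiber S P y), y₀ ∈ U ∧
      IsKernelFrame n FD S P U s) :
    ∃ (_ : TopologicalSpace (TotalSpace (EuclideanSpace ℂ (Fin r)) (KernelFiber S P)))
      (_ : ∀ y, TopologicalSpace (KernelFiber S P y))
      (_ : FiberBundle (EuclideanSpace ℂ (Fin r)) (KernelFiber S P))
      (_ : VectorBundle ℂ (EuclideanSpace ℂ (Fin r)) (KernelFiber S P)),
      ContMDiffVectorBundle ∞ (EuclideanSpace ℂ (Fin r)) (KernelFiber S P) (𝓡 n) ∧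
      ∀ t : ∀ y, KernelFiber S P y,
        ContMDiff (𝓡 n) ((𝓡 n).prod 𝓘(ℝ, EuclideanSpace ℂ (Fin r))) ∞
          (fun y => TotalSpace.mk' (EuclideanSpace ℂ (Fin r)) y (t y)) ↔
        ∀ y, ∀ σ, σ ∉ singPts S (P y) →
          ContMDiffAt ((𝓡 n).prod 𝓘(ℝ, ℂ)) ((𝓡 n).prod 𝓘(ℝ, FD)) ∞
            (fun p : Y × ℂ => TotalSpace.mk' FD p.1 ((t p.1).toFun p.2)) (y, σ) := by
  choose U s hmem hs using h
  let L : EuclideanSpace ℂ (Fin r) ≃L[ℂ] (Fin r → ℂ) := EuclideanSpace.equiv (Fin r) ℂ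
  let φ : ∀ _ y : Y, EuclideanSpace ℂ (Fin r) →ₗ[ℂ] KernelFiber S P y := fun i y =>
    Fintype.linearCombination ℂ (s i y) ∘ₗ L.toLinearEquiv.toLinearMap
  have hφL : ∀ i y c, φ i y (L.symm c) = Fintype.linearCombination ℂ (s i y) c := fun i y c =>
    congrArg (Fintype.linearCombination ℂ (s i y)) (L.apply_symm_apply c)
  -- The columns of the transition matrix are the coefficients of the `i`-th frame with respect to
  -- the `k`-th.
  let C : Y → Y → Y → EuclideanSpace ℂ (Fin r) →L[ℂ] EuclideanSpace ℂ (Fin r) := fun i k y =>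
    ∑ j, (EuclideanSpace.proj j : EuclideanSpace ℂ (Fin r) →L[ℂ] ℂ).smulRight
      (L.symm (frameCoeff (s k) (fun y => s i y j) y))
  have hC : ∀ i k, ContMDiffOn (𝓡 n)
      𝓘(ℝ, EuclideanSpace ℂ (Fin r) →L[ℂ] EuclideanSpace ℂ (Fin r)) ∞ (C i k) (U i ∩ U k) := by
    intro i k y hy
    refine (contMDiffAt_finsetSum fun j _ => ?_).contMDiffWithinAt
    -- Each member of the `i`-th frame is a section smooth off the singular set, so its coefficients
    -- in the `k`-th frame are smooth.
    have h1 := ((hs k).contMDiffAt_coeff_iff hy.2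
      ((hs k).linearCombination_frameCoeff fun y => s i y j)).2
      fun σ hσ => (hs i).smooth y hy.1 σ hσ j
    exact contMDiffAt_const_clm_apply (ContinuousLinearMap.smulRightL ℂ _ _
      (EuclideanSpace.proj j : EuclideanSpace ℂ (Fin r) →L[ℂ] ℂ))
      (contMDiffAt_const_clm_apply (L.symm : (Fin r → ℂ) →L[ℂ] EuclideanSpace ℂ (Fin r)) h1)
  have hCφ : ∀ i k, ∀ y ∈ U i ∩ U k, ∀ v, φ k y (C i k y v) = φ i y v := by
    intro i k y hy v
    have h1 : C i k y v = ∑ j, v j • L.symm (frameCoeff (s k) (fun y => s i y j) y) := by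
      simp only [C, sum_apply]
      rfl
    rw [h1, map_sum]
    simp only [map_smul, hφL]
    refine (Finset.sum_congr rfl fun j _ => ?_).trans
      (Fintype.linearCombination_apply ℂ (s i y) (L v)).symm
    rw [(hs k).linearCombination_frameCoeff (fun y => s i y j) y hy.2]
    rfl
  obtain ⟨i₁, i₂, i₃, i₄, hB, hsec⟩ := exists_contMDiffVectorBundle (n := n)
    (fun i => (hs i).isOpen) hmem (φ := φ)
    (fun i y hy => ((hs i).bijective y hy).comp L.bijective) hC hCφ
  refine ⟨i₁, i₂, i₃, i₄, hB, fun t => forall_congr' fun y₀ => ?_⟩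
  refine (hsec t y₀ (fun y => L.symm (frameCoeff (s y₀) t y)) fun y hy => ?_).trans ?_
  · rw [hφL, (hs y₀).linearCombination_frameCoeff t y hy]
  rw [← (hs y₀).contMDiffAt_coeff_iff (hmem y₀) ((hs y₀).linearCombination_frameCoeff t)]
  refine ⟨fun h => ?_, fun h =>
    contMDiffAt_const_clm_apply (L.symm : (Fin r → ℂ) →L[ℂ] EuclideanSpace ℂ (Fin r)) h⟩
  have h' := contMDiffAt_const_clm_apply (L : EuclideanSpace ℂ (Fin r) →L[ℂ] (Fin r → ℂ)) h
  exact h'.congr_of_eventuallyEq (.of_forall fun y => (L.apply_symm_apply _).symm)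

end Sections

end

end KernelBundle

theorem theorem3p1
    -- the base: a connected smooth manifold
    {n : ℕ} {Y : Type*} [TopologicalSpace Y] [ConnectedSpace Y]
    [ChartedSpace (EuclideanSpace ℝ (Fin n)) Y] [IsManifold (𝓡 n) ∞ Y]
    -- the smooth Hilbert space bundles, with their model spaces
    {FD F₁ F₂ : Type*}
    [NormedAddCommGroup FD] [InnerProductSpace ℂ FD] [CompleteSpace FD]
    [NormedAddCommGroup F₁] [InnerProductSpace ℂ F₁] [CompleteSpace F₁]
    [NormedAddCommGroup F₂] [InnerProductSpace ℂ F₂] [CompleteSpace F₂]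
    {D H₁ H₂ : Y → Type*}
    [∀ y, NormedAddCommGroup (D y)] [∀ y, InnerProductSpace ℂ (D y)]
    [TopologicalSpace (TotalSpace FD D)] [FiberBundle FD D] [VectorBundle ℂ FD D]
    [ContMDiffVectorBundle ∞ FD D (𝓡 n)]
    [∀ y, NormedAddCommGroup (H₁ y)] [∀ y, InnerProductSpace ℂ (H₁ y)]
    [TopologicalSpace (TotalSpace F₁ H₁)] [FiberBundle F₁ H₁] [VectorBundle ℂ F₁ H₁]
    [ContMDiffVectorBundle ∞ F₁ H₁ (𝓡 n)] (_hH₁ : HasUnitaryTrivializations F₁ H₁)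
    [∀ y, NormedAddCommGroup (H₂ y)] [∀ y, InnerProductSpace ℂ (H₂ y)]
    [TopologicalSpace (TotalSpace F₂ H₂)] [FiberBundle F₂ H₂] [VectorBundle ℂ F₂ H₂]
    [ContMDiffVectorBundle ∞ F₂ H₂ (𝓡 n)] (_hH₂ : HasUnitaryTrivializations F₂ H₂)
    -- the embedding of `D` in `H₁`
    (j : FD →L[ℂ] F₁) (i : ∀ y, D y →L[ℂ] H₁ y) (_hi : IsDenseSubbundle n j i)
    -- the family of operators
    (S : Set ℂ) (_hSo : IsOpen S) (_hSc : IsConnected S)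
    (P : ∀ y, ℂ → D y →L[ℂ] H₂ y)
    (_hP : IsHolomorphicFredholmFamily n FD F₂ i S P)
    -- finiteness, closedness and local boundedness of the singular set
    (_hfin : ∀ y, (singPts S (P y)).Finite)
    (_hclosed : IsClosed (singGraph S P))
    (_hbdd : ∀ y₀ : Y, ∃ U ∈ 𝓝 y₀, Bornology.IsBounded (⋃ y ∈ U, singPts S (P y))) :
    ∃ (r : ℕ)
      (_ : TopologicalSpace (TotalSpace (EuclideanSpace ℂ (Fin r)) (KernelFiber S P)))
      (_ : ∀ y, TopologicalSpace (KernelFiber S P y))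
      (_ : FiberBundle (EuclideanSpace ℂ (Fin r)) (KernelFiber S P))
      (_ : VectorBundle ℂ (EuclideanSpace ℂ (Fin r)) (KernelFiber S P)),
      ContMDiffVectorBundle ∞ (EuclideanSpace ℂ (Fin r)) (KernelFiber S P) (𝓡 n) ∧
      ∀ s : ∀ y, KernelFiber S P y,
        ContMDiff (𝓡 n) ((𝓡 n).prod 𝓘(ℝ, EuclideanSpace ℂ (Fin r))) ∞
          (fun y => TotalSpace.mk' (EuclideanSpace ℂ (Fin r)) y (s y)) ↔
        IsSmoothOffSing n FD S P s := by
  have hF := _hP.isFredholmOn _hfin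
  have hcD : ∀ y, CompleteSpace (D y) := fun y => completeSpace_of_equiv
    ((trivializationAt FD D y).continuousLinearEquivAt ℂ y (mem_baseSet_trivializationAt FD D y))
  have hcH : ∀ y, CompleteSpace (H₂ y) := fun y => completeSpace_of_equiv
    ((trivializationAt F₂ H₂ y).continuousLinearEquivAt ℂ y (mem_baseSet_trivializationAt F₂ H₂ y))
  obtain ⟨r, hr⟩ := exists_isKernelFrame_of_const_rank
    (exists_isKernelFrame _hSo _hP.smooth hF _hclosed _hbdd)
  obtain ⟨i₁, i₂, i₃, i₄, hB, hsec⟩ := exists_kernelBundle hr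
  exact ⟨r, i₁, i₂, i₃, i₄, hB, fun s =>
    (hsec s).trans (isSmoothOffSing_iff _hSo hF _hclosed s).symm⟩
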